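/- Let $n\ge p\ge 1$, let $M^n$ be a connected closed smooth $n$-manifold, and let $f\colon M^n\to\mathbb R^p$ be a special generic map, i.e. a smooth map such that around every singular point $x$ of $f$ (a point where $df_x$ is not surjective) and around $f(x)$ there are smooth coordinates $x_1,\dots,x_n$ and $y_1,\dots,y_p$, centred at $x$ and $f(x)$, in which $y_i\circ f=x_i$ for $1\le i\le p-1$ and $y_p\circ f=\pm(x_p^2+\dots+x_n^2)$. Let $W_f=M/\!\sim_f$ with the quotient topology, where $x_1\sim_f x_2$ if $f(x_1)=f(x_2)=:y$ and $x_1,x_2$ lie in the same connected component of $f^{-1}(y)$. Let $q_f\colon M\to W_f$ be the quotient map and $\overline f\colon W_f\to\mathbb R^p$ the map with $f=\overline f\circ q_f$. Suppose that $f(M^n)=D^p=\{x\in\mathbb R^p : \|x\|\le 1\}$ and that $\overline f$ is injective. Then $M^n$ is a homotopy sphere (it is homotopy equivalent to $S^n$) and $f$ is standard. The latter means that $p<n$ and that $W_f$ is diffeomorphic to $D^p$; here $W_f$ carries its structure of a smooth $p$-manifold with boundary for which $q_f$ is smooth, $q_f^{-1}(\partial W_f)$ is the set of singular points of $f$, and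 $\overline f$ is an immersion (such a structure exists, and $W_f$ with any such structure is diffeomorphic to $D^p$). -/

import Mathlib

open scoped Manifold ContDiff Topology ContinuousMap

noncomputable section

/-! ### The closed unit ball as a smooth manifold with boundary

For `v = e₀` the inversion `x ↦ 2 (x + v) / ‖x + v‖² - v` about the point `-v` is an involution of
`ℝᵖ ∖ {-v}` that exchanges the closed unit ball minus the point `-v` and the closed half-space
`{y | 0 ≤ y₀}`. It is one chart of the closed ball; its composition with `x ↦ -x` is the other one.
Both charts are restrictions of diffeomorphisms between open subsets of `ℝᵖ`, so that this is the
usual smooth structure of the closed ball as a codimension zero submanifold with boundary. -/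

namespace ClosedDisk

variable {p : ℕ} [NeZero p]

/-- The first vector of the standard basis. -/
def pole (p : ℕ) [NeZero p] : EuclideanSpace ℝ (Fin p) := EuclideanSpace.single 0 1

/-- Inversion about `-e₀` in the sphere of radius `√2`. -/
def cayley (x : EuclideanSpace ℝ (Fin p)) : EuclideanSpace ℝ (Fin p) :=
  (2 / ‖x + pole p‖ ^ 2) • (x + pole p) - pole p

theorem norm_add_pole_sq (x : EuclideanSpace ℝ (Fin p)) :
    ‖x + pole p‖ ^ 2 = ‖x‖ ^ 2 + 2 * x 0 + 1 := by
  rw [norm_add_sq_real]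
  simp [pole, EuclideanSpace.inner_single_right]

theorem cayley_apply_zero (x : EuclideanSpace ℝ (Fin p)) (hx : x + pole p ≠ 0) :
    cayley x 0 = (1 - ‖x‖ ^ 2) / ‖x + pole p‖ ^ 2 := by
  have h : ‖x + pole p‖ ^ 2 ≠ 0 := by simpa using hx
  have h1 : cayley x 0 = 2 / ‖x + pole p‖ ^ 2 * (x 0 + 1) - 1 := by
    simp [cayley, pole, mul_add]
  rw [h1, eq_div_iff h, sub_mul, mul_right_comm, div_mul_cancel₀ _ h, norm_add_pole_sq]
  ring

theorem cayley_add_pole (x : EuclideanSpace ℝ (Fin p)) :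
    cayley x + pole p = (2 / ‖x + pole p‖ ^ 2) • (x + pole p) := by
  simp [cayley]

theorem cayley_add_pole_ne (x : EuclideanSpace ℝ (Fin p)) (hx : x + pole p ≠ 0) :
    cayley x + pole p ≠ 0 := by
  have h : ‖x + pole p‖ ^ 2 ≠ 0 := by simpa using hx
  rw [cayley_add_pole]
  exact smul_ne_zero (div_ne_zero two_ne_zero h) hx

theorem cayley_cayley (x : EuclideanSpace ℝ (Fin p)) (hx : x + pole p ≠ 0) :
    cayley (cayley x) = x := by
  have h : ‖x + pole p‖ ≠ 0 := by simpa using hx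
  have h2 : ‖cayley x + pole p‖ ^ 2 = 4 / ‖x + pole p‖ ^ 2 := by
    rw [cayley_add_pole, norm_smul, mul_pow, Real.norm_eq_abs, sq_abs]
    field_simp
    norm_num
  rw [cayley, h2, cayley_add_pole, smul_smul]
  have h3 : 2 / (4 / ‖x + pole p‖ ^ 2) * (2 / ‖x + pole p‖ ^ 2) = 1 := by
    field_simp
    norm_num
  rw [h3, one_smul, add_sub_cancel_right]

theorem add_pole_ne_of_nonneg (y : EuclideanSpace ℝ (Fin p)) (hy : 0 ≤ y 0) :
    y + pole p ≠ 0 := by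
  intro h
  have := norm_add_pole_sq y
  rw [h] at this
  simp only [norm_zero] at this
  nlinarith [sq_nonneg ‖y‖]

theorem norm_cayley_le_one (y : EuclideanSpace ℝ (Fin p)) (hy : 0 ≤ y 0) : ‖cayley y‖ ≤ 1 := by
  have h0 := add_pole_ne_of_nonneg y hy
  have h1 := cayley_apply_zero _ (cayley_add_pole_ne y h0)
  rw [cayley_cayley y h0] at h1
  have h2 : 0 < ‖cayley y + pole p‖ ^ 2 := by
    have := norm_pos_iff.2 (cayley_add_pole_ne y h0)
    positivity
  by_contra! h3
  have h4 : (1 - ‖cayley y‖ ^ 2) / ‖cayley y + pole p‖ ^ 2 < 0 :=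
    div_neg_of_neg_of_pos (by nlinarith) h2
  linarith

theorem cayley_nonneg (x : EuclideanSpace ℝ (Fin p)) (hx : ‖x‖ ≤ 1) : 0 ≤ cayley x 0 ∨
    x + pole p = 0 := by
  by_cases h : x + pole p = 0
  · exact Or.inr h
  · left
    rw [cayley_apply_zero x h]
    have : 0 ≤ 1 - ‖x‖ ^ 2 := by nlinarith [norm_nonneg x]
    positivity

theorem contDiffOn_cayley :
    ContDiffOn ℝ ∞ (cayley (p := p)) {x | x + pole p ≠ 0} := by
  have h : ContDiff ℝ ∞ (fun x : EuclideanSpace ℝ (Fin p) => x + pole p) :=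
    contDiff_id.add contDiff_const
  have h1 : ContDiffOn ℝ ∞ (fun x : EuclideanSpace ℝ (Fin p) => 2 / ‖x + pole p‖ ^ 2)
      {x | x + pole p ≠ 0} := by
    refine ContDiffOn.div contDiffOn_const (h.norm_sq ℝ).contDiffOn ?_
    intro x hx
    simpa using hx
  exact (h1.smul h.contDiffOn).sub contDiffOn_const

open Classical in
/-- The chart of the closed unit ball given by inversion, defined away from `-e₀`. -/
def chartPos (p : ℕ) [NeZero p] :
    OpenPartialHomeomorph (Metric.closedBall (0 : EuclideanSpace ℝ (Fin p)) 1)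
      (EuclideanHalfSpace p) where
  toFun x := if h : 0 ≤ cayley (x : EuclideanSpace ℝ (Fin p)) 0 then ⟨cayley x, h⟩ else 0
  invFun y := ⟨cayley y.1, mem_closedBall_zero_iff.2 (norm_cayley_le_one y.1 y.2)⟩
  source := {x | (x : EuclideanSpace ℝ (Fin p)) + pole p ≠ 0}
  target := Set.univ
  map_source' _ _ := Set.mem_univ _
  map_target' y _ := cayley_add_pole_ne _ (add_pole_ne_of_nonneg y.1 y.2)
  left_inv' x hx := by
    have h : 0 ≤ cayley (x : EuclideanSpace ℝ (Fin p)) 0 :=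
      (cayley_nonneg x.1 (mem_closedBall_zero_iff.1 x.2)).resolve_right hx
    apply Subtype.ext
    simp only [h, dite_true]
    exact cayley_cayley _ hx
  right_inv' y _ := by
    have h := cayley_cayley _ (add_pole_ne_of_nonneg y.1 y.2)
    have h0 : 0 ≤ cayley (cayley y.1) 0 := by rw [h]; exact y.2
    simp only [h0, dite_true]
    exact Subtype.ext h
  open_source := isOpen_ne_fun (by fun_prop) continuous_const
  open_target := isOpen_univ
  continuousOn_toFun := by
    refine (Topology.IsInducing.subtypeVal (t := {y : EuclideanSpace ℝ (Fin p) |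
      0 ≤ y 0})).continuousOn_iff.2 ?_
    have h : ContinuousOn
        (fun x : Metric.closedBall (0 : EuclideanSpace ℝ (Fin p)) 1 => cayley x.1)
        {x | (x : EuclideanSpace ℝ (Fin p)) + pole p ≠ 0} :=
      contDiffOn_cayley.continuousOn.comp continuous_subtype_val.continuousOn fun _ hx => hx
    refine h.congr fun x hx => ?_
    have h : 0 ≤ cayley (x : EuclideanSpace ℝ (Fin p)) 0 :=
      (cayley_nonneg x.1 (mem_closedBall_zero_iff.1 x.2)).resolve_right hx
    simp [h]
  continuousOn_invFun := by
    rw [Topology.IsInducing.subtypeVal.continuousOn_iff]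
    exact contDiffOn_cayley.continuousOn.comp continuous_subtype_val.continuousOn
      fun y _ => add_pole_ne_of_nonneg y.1 y.2

/-- The antipodal map of the closed unit ball. -/
def antipode (p : ℕ) : Metric.closedBall (0 : EuclideanSpace ℝ (Fin p)) 1 ≃ₜ
    Metric.closedBall (0 : EuclideanSpace ℝ (Fin p)) 1 where
  toFun x := ⟨-x.1, by simp [mem_closedBall_zero_iff.1 x.2]⟩
  invFun x := ⟨-x.1, by simp [mem_closedBall_zero_iff.1 x.2]⟩
  left_inv x := by simp
  right_inv x := by simp

/-- The second chart of the closed unit ball, defined away from `e₀`. -/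
def chartNeg (p : ℕ) [NeZero p] :
    OpenPartialHomeomorph (Metric.closedBall (0 : EuclideanSpace ℝ (Fin p)) 1)
      (EuclideanHalfSpace p) :=
  (antipode p).toOpenPartialHomeomorph.trans (chartPos p)

theorem mem_chartNeg_source (x : Metric.closedBall (0 : EuclideanSpace ℝ (Fin p)) 1)
    (hx : x ∉ (chartPos p).source) : x ∈ (chartNeg p).source := by
  have h : (x : EuclideanSpace ℝ (Fin p)) + pole p = 0 := by
    simpa [chartPos] using hx
  have h1 : -(x : EuclideanSpace ℝ (Fin p)) + pole p ≠ 0 := by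
    rw [eq_neg_of_add_eq_zero_left h, neg_neg]
    exact add_pole_ne_of_nonneg _ (by simp [pole])
  simpa [chartNeg, chartPos, antipode] using h1

open Classical in
instance : ChartedSpace (EuclideanHalfSpace p)
    (Metric.closedBall (0 : EuclideanSpace ℝ (Fin p)) 1) where
  atlas := {chartPos p, chartNeg p}
  chartAt x := if x ∈ (chartPos p).source then chartPos p else chartNeg p
  mem_chart_source x := by
    by_cases h : x ∈ (chartPos p).source
    · simp [h]
    · simpa [h] using mem_chartNeg_source x h
  chart_mem_atlas x := by
    by_cases h : x ∈ (chartPos p).source <;> simp [h]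

theorem chartPos_apply (x : Metric.closedBall (0 : EuclideanSpace ℝ (Fin p)) 1)
    (hx : (x : EuclideanSpace ℝ (Fin p)) + pole p ≠ 0) :
    (chartPos p x).1 = cayley x.1 := by
  have h : 0 ≤ cayley (x : EuclideanSpace ℝ (Fin p)) 0 :=
    (cayley_nonneg x.1 (mem_closedBall_zero_iff.1 x.2)).resolve_right hx
  simp [chartPos, h]

/-- Both transition maps between the two charts are given by `y ↦ cayley (-cayley y)`. -/
theorem contDiffOn_transition :
    ContDiffOn ℝ ∞ (fun y : EuclideanSpace ℝ (Fin p) => cayley (-cayley y))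
      {y | 0 ≤ y 0 ∧ -cayley y + pole p ≠ 0} :=
  contDiffOn_cayley.comp
    ((contDiffOn_cayley.mono fun y hy => add_pole_ne_of_nonneg y hy.1).neg) fun _ hy => hy.2

instance : IsManifold (𝓡∂ p) ∞ (Metric.closedBall (0 : EuclideanSpace ℝ (Fin p)) 1) := by
  refine isManifold_of_contDiffOn _ _ _ ?_
  rintro e e' he he'
  have hself : ∀ f : OpenPartialHomeomorph (Metric.closedBall (0 : EuclideanSpace ℝ (Fin p)) 1)
      (EuclideanHalfSpace p), ContDiffOn ℝ ∞ ((𝓡∂ p) ∘ (f.symm.trans f) ∘ (𝓡∂ p).symm)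
      ((𝓡∂ p).symm ⁻¹' (f.symm.trans f).source ∩ Set.range (𝓡∂ p)) := fun f => by
    have := symm_trans_mem_contDiffGroupoid (n := ∞) (I := 𝓡∂ p) f
    rw [contDiffGroupoid, mem_groupoid_of_pregroupoid] at this
    exact this.1
  rcases he with rfl | rfl <;> rcases he' with rfl | rfl
  · exact hself _
  · refine contDiffOn_transition.congr_mono ?_ ?_
    · rintro y ⟨hy, z, rfl⟩
      have hz : (𝓡∂ p).symm ((𝓡∂ p) z) = z := (𝓡∂ p).left_inv z
      simp only [Set.mem_preimage, hz] at hy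
      simp only [Function.comp_apply, hz]
      exact chartPos_apply _ hy.2.2
    · rintro y ⟨hy, z, rfl⟩
      have hz : (𝓡∂ p).symm ((𝓡∂ p) z) = z := (𝓡∂ p).left_inv z
      simp only [Set.mem_preimage, hz] at hy
      exact ⟨z.2, hy.2.2⟩
  · refine contDiffOn_transition.congr_mono ?_ ?_
    · rintro y ⟨hy, z, rfl⟩
      have hz : (𝓡∂ p).symm ((𝓡∂ p) z) = z := (𝓡∂ p).left_inv z
      simp only [Set.mem_preimage, hz] at hy
      simp only [Function.comp_apply, hz]
      exact chartPos_apply _ hy.2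
    · rintro y ⟨hy, z, rfl⟩
      have hz : (𝓡∂ p).symm ((𝓡∂ p) z) = z := (𝓡∂ p).left_inv z
      simp only [Set.mem_preimage, hz] at hy
      exact ⟨z.2, hy.2⟩
  · exact hself _

end ClosedDisk

/-! ### Special generic maps -/

/-- The singular locus: the points where the differential is not surjective. It is used for maps
with `p ≤ n` only. -/
def singularLocus (n : ℕ) {p : ℕ} {M : Type*} [TopologicalSpace M]
    [ChartedSpace (EuclideanSpace ℝ (Fin n)) M]
    (f : M → EuclideanSpace ℝ (Fin p)) : Set M :=
  {x | ¬ Function.Surjective (mfderiv (𝓡 n) (𝓡 p) f x)}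

/-- `x` is a fold point of `f` with exactly `l` positive squares: in suitable smooth coordinates
`x₁, …, xₙ` centred at `x` and `y₁, …, yₚ` centred at `f x`, the map `f` has the form `yᵢ = xᵢ` for
`i < p` and `yₚ = xₚ² + ⋯ + xₚ₊ₗ₋₁² - xₚ₊ₗ² - ⋯ - xₙ²`. The coordinate `xₖ` is the component of
index `k - 1`. -/
def IsFoldPoint (n : ℕ) {p : ℕ} {M : Type*} [TopologicalSpace M]
    [ChartedSpace (EuclideanSpace ℝ (Fin n)) M]
    (f : M → EuclideanSpace ℝ (Fin p)) (x : M) (l : ℕ) : Prop :=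
  ∃ φ ∈ IsManifold.maximalAtlas (𝓡 n) ∞ M,
  ∃ ψ ∈ IsManifold.maximalAtlas (𝓡 p) ∞ (EuclideanSpace ℝ (Fin p)),
    x ∈ φ.source ∧ φ x = 0 ∧ ψ (f x) = 0 ∧ φ.source ⊆ f ⁻¹' ψ.source ∧
    ∀ z ∈ φ.source,
      (∀ (i : Fin n) (j : Fin p), (i : ℕ) = j → (j : ℕ) + 1 < p → ψ (f z) j = φ z i) ∧
      (∀ j : Fin p, (j : ℕ) + 1 = p →
        ψ (f z) j = ∑ i : Fin n,
          if (i : ℕ) + 1 < p then 0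
          else if (i : ℕ) + 1 < p + l then (φ z i) ^ 2
          else -(φ z i) ^ 2)

/-- A definite fold point: a fold point of absolute index `max l (n - p + 1 - l) = n - p + 1`. -/
def IsDefiniteFoldPoint (n : ℕ) {p : ℕ} {M : Type*} [TopologicalSpace M]
    [ChartedSpace (EuclideanSpace ℝ (Fin n)) M]
    (f : M → EuclideanSpace ℝ (Fin p)) (x : M) : Prop :=
  ∃ l ≤ n + 1 - p, max l (n + 1 - p - l) = n + 1 - p ∧ IsFoldPoint n f x l

/-- A special generic map is a smooth map, from dimension `n` to dimension `p ≤ n` with `1 ≤ p`, all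
of whose singular points are definite fold points. -/
def IsSpecialGeneric (n : ℕ) {p : ℕ} {M : Type*} [TopologicalSpace M]
    [ChartedSpace (EuclideanSpace ℝ (Fin n)) M]
    (f : M → EuclideanSpace ℝ (Fin p)) : Prop :=
  1 ≤ p ∧ p ≤ n ∧ ContMDiff (𝓡 n) (𝓡 p) ∞ f ∧ ∀ x ∈ singularLocus n f, IsDefiniteFoldPoint n f x

/-! ### Stein factorization -/

section Stein

variable {X Y : Type*} [TopologicalSpace X]

/-- Two points are equivalent if they have the same image `y` and lie in the same connected
component of the fibre over `y`. -/
def steinSetoid (f : X → Y) : Setoid X where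
  r x₁ x₂ := f x₁ = f x₂ ∧ x₂ ∈ connectedComponentIn (f ⁻¹' {f x₁}) x₁
  iseqv :=
    { refl := fun _ => ⟨rfl, mem_connectedComponentIn rfl⟩
      symm := fun {x₁ x₂} h => by
        refine ⟨h.1.symm, ?_⟩
        rw [← h.1, ← connectedComponentIn_eq h.2]
        exact mem_connectedComponentIn rfl
      trans := fun {x₁ x₂ x₃} h h' => by
        refine ⟨h.1.trans h'.1, ?_⟩
        rw [connectedComponentIn_eq h.2, h.1]
        exact h'.2 }

/-- The space `W_f` of the Stein factorization, with the quotient topology. -/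
abbrev SteinSpace (f : X → Y) : Type _ := Quotient (steinSetoid f)

/-- The quotient map `q_f`. -/
def steinProj (f : X → Y) : X → SteinSpace f := Quotient.mk (steinSetoid f)

/-- The induced map on the Stein factorization, with `steinMap f ∘ steinProj f = f`. -/
def steinMap (f : X → Y) : SteinSpace f → Y := Quotient.lift f fun _ _ h => h.1

end Stein

/-! ### Standard special generic maps on homotopy spheres -/

/-- A closed smooth `n`-manifold is a homotopy sphere if it is homotopy equivalent to `Sⁿ`. -/
def IsHomotopySphere (n : ℕ) (M : Type*) [TopologicalSpace M]
    [ChartedSpace (EuclideanSpace ℝ (Fin n)) M] : Prop :=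
  IsManifold (𝓡 n) ∞ M ∧ T2Space M ∧ CompactSpace M ∧
    Nonempty (M ≃ₕ Metric.sphere (0 : EuclideanSpace ℝ (Fin (n + 1))) 1)

/-- The charts `cs` make `W_f`, with its quotient topology, a smooth `p`-manifold with boundary
such that `q_f` is smooth, the preimage of the boundary under `q_f` is the singular locus of `f`,
and the induced map from `W_f` to `ℝᵖ` is an immersion. For a special generic map with `p < n` this
is the smooth structure carried by the Stein factorization; it is unique because the induced map is
an immersion between manifolds of the same dimension. -/
structure IsSteinStructure (n : ℕ) {p : ℕ} [NeZero p] {M : Type*} [TopologicalSpace M]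
    [ChartedSpace (EuclideanSpace ℝ (Fin n)) M]
    (f : M → EuclideanSpace ℝ (Fin p))
    (cs : ChartedSpace (EuclideanHalfSpace p) (SteinSpace f)) : Prop where
  isManifold : IsManifold (𝓡∂ p) ∞ (SteinSpace f)
  t2 : T2Space (SteinSpace f)
  secondCountable : SecondCountableTopology (SteinSpace f)
  smooth_proj : ContMDiff (𝓡 n) (𝓡∂ p) ∞ (steinProj f)
  preimage_boundary :
    steinProj f ⁻¹' (𝓡∂ p).boundary (SteinSpace f) = singularLocus n f
  immersion_map : Manifold.IsImmersion (𝓡∂ p) (𝓡 p) ∞ (steinMap f)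

/-- A special generic map with `p < n` on a homotopy sphere is standard if its Stein factorization
`W_f`, as a smooth manifold with boundary, is diffeomorphic to the closed unit ball: the smooth
structure on `W_f` exists, and `W_f` with this structure is diffeomorphic to the ball. -/
def IsStandard (n : ℕ) {p : ℕ} [NeZero p] {M : Type*} [TopologicalSpace M]
    [ChartedSpace (EuclideanSpace ℝ (Fin n)) M]
    (f : M → EuclideanSpace ℝ (Fin p)) : Prop :=
  IsHomotopySphere n M ∧ IsSpecialGeneric n f ∧ p < n ∧
  (∃ cs : ChartedSpace (EuclideanHalfSpace p) (SteinSpace f), IsSteinStructure n f cs) ∧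
  ∀ cs : ChartedSpace (EuclideanHalfSpace p) (SteinSpace f), IsSteinStructure n f cs →
    Nonempty (Diffeomorph (𝓡∂ p) (𝓡∂ p) (SteinSpace f)
      (Metric.closedBall (0 : EuclideanSpace ℝ (Fin p)) 1) ∞)

end

/-! Injectivity of `steinMap f` says that the fibres of `f` are connected. At a definite fold all
squares have one sign, so a singular point is isolated in its fibre and therefore is the whole
fibre. By compactness, values close to `f x` then come only from the fold chart, which reaches just
one side of the fold. Since the image is the full ball, `f x` lies on the unit sphere. Conversely
`f` is open at regular points, so these go to the interior. Hence the singular locus is the preimage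
of the sphere, and each value on the sphere is taken once (`IsSpecialGeneric.singularLocus_eq`,
`IsSpecialGeneric.eq_of_norm_eq_one`).

Fix a unit vector `b` and take the height function `⟪b, f⟫`. It is regular where `f` is. At a
singular point the differential of `f` has image the hyperplane orthogonal to `f x`, so the height
is critical only where `f x = ± b`: at one maximum and one minimum. Both are nondegenerate: the
bound `‖f‖ ≤ 1` makes the second order condition strict off the kernel of the differential, and the
squares of the fold make it strict on the kernel (`IsFoldForm.exists_radial`).

Reeb's theorem then makes `M` a topological sphere
(`exists_isOpenEmbedding_of_two_critical_points`). In place of a gradient flow, finitely many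
chart-supported homeomorphisms that increase the height are composed to one whose only fixed points
are the two critical points and which is a linear contraction near the maximum. All orbits off the
minimum run into that contraction, so the complement of the minimum is a copy of `ℝⁿ`, and `M` is
its one-point compactification.

The induced map from `W_f` to the ball is a continuous bijection from a compact space to a Hausdorff
space, hence a homeomorphism, along which the smooth structure of the ball is pulled back. Any other
Stein structure agrees with it because both maps to `ℝᵖ` are immersions. Finally `p = n` is
impossible, since an equidimensional fold has disconnected fibres nearby. -/

/-! ### Extending homeomorphisms of a chart by the identity -/

section ExtendById

variable {M E : Type*} [TopologicalSpace M]

open Classical in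
/-- The map that is `h` in the chart `φ`, and the identity off its domain. -/
noncomputable def OpenPartialHomeomorph.conjExtend [TopologicalSpace E]
    (φ : OpenPartialHomeomorph M E) (h : E → E) (x : M) : M :=
  if x ∈ φ.source then φ.symm (h (φ x)) else x

namespace OpenPartialHomeomorph

variable [TopologicalSpace E] {φ : OpenPartialHomeomorph M E} {h h' : E → E} {K : Set E}

theorem conjExtend_of_mem {x : M} (hx : x ∈ φ.source) :
    φ.conjExtend h x = φ.symm (h (φ x)) := if_pos hx

theorem conjExtend_symm_apply {y : E} (hy : y ∈ φ.target) :
    φ.conjExtend h (φ.symm y) = φ.symm (h y) := by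
  rw [conjExtend_of_mem (φ.map_target hy), φ.right_inv hy]

theorem conjExtend_of_notMem {x : M} (hK : ∀ y ∉ K, h y = y) (hx : x ∉ φ.symm '' K) :
    φ.conjExtend h x = x := by
  by_cases hs : x ∈ φ.source
  · rw [conjExtend_of_mem hs, hK, φ.left_inv hs]
    exact fun hy => hx ⟨_, hy, φ.left_inv hs⟩
  · exact if_neg hs

theorem conjExtend_conjExtend (hK : K ⊆ φ.target) (hid : ∀ y ∉ K, h y = y)
    (hinv : Function.LeftInverse h' h) (x : M) :
    φ.conjExtend h' (φ.conjExtend h x) = x := by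
  by_cases hs : x ∈ φ.source
  · have hmem : h (φ x) ∈ φ.target := by
      by_cases hy : h (φ x) ∈ K
      · exact hK hy
      -- A value outside `K` is fixed by `h`, so by injectivity its preimage is that same point.
      -- This is why `h` preserves the target of the chart.
      · rw [hinv.injective (hid _ hy)]; exact φ.map_source hs
    rw [conjExtend_of_mem hs, conjExtend_symm_apply hmem, hinv, φ.left_inv hs]
  · have h1 : ∀ h : E → E, φ.conjExtend h x = x := fun h => if_neg hs
    rw [h1, h1]

/-- Off the chart, Hausdorffness matters: the image of `K` is compact, hence closed in `M`, and the
map is the identity on its open complement. -/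
theorem continuous_conjExtend [T2Space M] (hh : Continuous h) (hinj : Function.Injective h)
    (hKc : IsCompact K) (hK : K ⊆ φ.target) (hid : ∀ y ∉ K, h y = y) :
    Continuous (φ.conjExtend h) := by
  rw [continuous_iff_continuousAt]
  intro x
  by_cases hx : x ∈ φ.source
  · have hmem : h (φ x) ∈ φ.target := by
      by_cases hy : h (φ x) ∈ K
      · exact hK hy
      · rw [hinj (hid _ hy)]; exact φ.map_source hx
    have : ContinuousAt (fun z => φ.symm (h (φ z))) x :=
      (φ.continuousAt_symm hmem).tendsto.comp
        ((hh.tendsto (φ x)).comp (φ.continuousAt hx))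
    refine this.congr ?_
    filter_upwards [φ.open_source.mem_nhds hx] with z hz using (conjExtend_of_mem hz).symm
  · have hcl : IsClosed (φ.symm '' K) :=
      (hKc.image_of_continuousOn (φ.continuousOn_symm.mono hK)).isClosed
    have hx' : x ∉ φ.symm '' K := by
      rintro ⟨y, hy, rfl⟩
      exact hx (φ.map_target (hK hy))
    refine continuousAt_id.congr ?_
    filter_upwards [hcl.isOpen_compl.mem_nhds hx'] with z hz using
      (conjExtend_of_notMem hid hz).symm

/-- A homeomorphism of the model space that is the identity off a compact subset of the target of a
chart, extended by the identity to a homeomorphism of the whole space. -/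
noncomputable def conjHomeomorph [T2Space M] (φ : OpenPartialHomeomorph M E) (h : E ≃ₜ E)
    (hKc : IsCompact K) (hK : K ⊆ φ.target) (hid : ∀ y ∉ K, h y = y) : M ≃ₜ M :=
  have hid' : ∀ y ∉ K, h.symm y = y := fun y hy => by
    rw [Homeomorph.symm_apply_eq, hid y hy]
  { toFun := φ.conjExtend h
    invFun := φ.conjExtend h.symm
    left_inv := conjExtend_conjExtend hK hid h.left_inv
    right_inv := conjExtend_conjExtend hK hid' h.right_inv
    continuous_toFun := continuous_conjExtend h.continuous h.injective hKc hK hid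
    continuous_invFun := continuous_conjExtend h.symm.continuous h.symm.injective hKc hK hid' }

theorem coe_conjHomeomorph [T2Space M] (φ : OpenPartialHomeomorph M E) (h : E ≃ₜ E)
    (hKc : IsCompact K) (hK : K ⊆ φ.target) (hid : ∀ y ∉ K, h y = y) :
    ⇑(φ.conjHomeomorph h hKc hK hid) = φ.conjExtend h := rfl

end OpenPartialHomeomorph

end ExtendById

/-! ### Small perturbations of the identity -/

section Perturbation

variable {E : Type*} [NormedAddCommGroup E] [NormedSpace ℝ E] [CompleteSpace E]

/-- The identity plus a Lipschitz map of small constant is a homeomorphism. -/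
theorem LipschitzWith.exists_homeomorph_id_add {W : E → E} {c : NNReal} (hW : LipschitzWith c W)
    (hc : c < 1) : ∃ h : E ≃ₜ E, ∀ x, h x = x + W x := by
  have happ : ApproximatesLinearOn (fun x => x + W x)
      ((ContinuousLinearEquiv.refl ℝ E : E ≃L[ℝ] E) : E →L[ℝ] E) Set.univ c := by
    intro x _ y _
    have h1 : x + W x - (y + W y) - ((ContinuousLinearEquiv.refl ℝ E : E ≃L[ℝ] E) : E →L[ℝ] E)
        (x - y) = W x - W y := by
      simp only [ContinuousLinearEquiv.coe_refl, ContinuousLinearMap.coe_id', id_eq]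
      abel
    change ‖x + W x - (y + W y) - _‖ ≤ _
    rw [h1]
    exact hW.norm_sub_le x y
  -- The identity has norm 1 only on a nontrivial space, so the zero space is separate.
  have hsub : Subsingleton E ∨
      c < ‖((ContinuousLinearEquiv.refl ℝ E).symm : E →L[ℝ] E)‖₊⁻¹ := by
    rcases subsingleton_or_nontrivial E with h | h
    · exact Or.inl h
    · right
      have : ‖((ContinuousLinearEquiv.refl ℝ E).symm : E →L[ℝ] E)‖₊ = 1 := by
        rw [← NNReal.coe_inj]
        simp
      rw [this, inv_one]
      exact hc
  exact ⟨happ.toHomeomorph _ hsub, fun x => rfl⟩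

/-- A smooth compactly supported vector field integrates, for one small step, to a
homeomorphism. -/
theorem exists_homeomorph_add_smul [FiniteDimensional ℝ E] {W : E → E} (hW : ContDiff ℝ 1 W)
    (hc : HasCompactSupport W) {δ : ℝ} (hδ : 0 < δ) :
    ∃ ε : ℝ, 0 < ε ∧ ε < δ ∧ ∃ h : E ≃ₜ E, ∀ x, h x = x + ε • W x := by
  obtain ⟨C, hC⟩ := hW.lipschitzWith_of_hasCompactSupport hc one_ne_zero
  -- The second bound makes the Lipschitz constant `ε * C` less than 1; adding 1 covers `C = 0`.
  set ε : ℝ := min (δ / 2) (1 / (2 * (C + 1))) with hε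
  have hC0 : (0 : ℝ) ≤ C := C.2
  have hε0 : 0 < ε := lt_min (by positivity) (by positivity)
  have hlt : ε < δ := (min_le_left _ _).trans_lt (by linarith)
  refine ⟨ε, hε0, hlt, ?_⟩
  have hlip : LipschitzWith (‖ε‖₊ * C) (fun x => ε • W x) :=
    (lipschitzWith_smul ε).comp hC
  refine hlip.exists_homeomorph_id_add ?_
  rw [← NNReal.coe_lt_coe]
  simp only [NNReal.coe_mul, coe_nnnorm, NNReal.coe_one, Real.norm_eq_abs, abs_of_pos hε0]
  calc ε * C ≤ 1 / (2 * (C + 1)) * C := by gcongr; exact min_le_right _ _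
    _ = C / (2 * (C + 1)) := by ring
    _ < 1 := by rw [div_lt_one (by positivity)]; linarith

end Perturbation

/-! ### Homeomorphisms that increase a function -/

/-- Every point is fixed or moved to a point at which `g` is larger. -/
def IsIncreasingFor {M : Type*} (g : M → ℝ) (Ψ : M → M) : Prop :=
  ∀ x, Ψ x = x ∨ g x < g (Ψ x)

namespace IsIncreasingFor

variable {M : Type*} {g : M → ℝ} {Ψ Ψ' : M → M}

theorem comp (h' : IsIncreasingFor g Ψ') (h : IsIncreasingFor g Ψ) :
    IsIncreasingFor g (Ψ' ∘ Ψ) := fun x => by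
  rcases h x with h1 | h1
  · simpa [h1] using h' x
  · right
    rcases h' (Ψ x) with h2 | h2
    · simpa [h2] using h1
    · exact h1.trans h2

/-- If some factor moved the point, `g` would have strictly increased and the point could not
return. Increasing maps can thus be composed without their moves cancelling. -/
theorem comp_eq_self (h' : IsIncreasingFor g Ψ') (h : IsIncreasingFor g Ψ) {x : M}
    (hx : Ψ' (Ψ x) = x) : Ψ x = x ∧ Ψ' x = x := by
  rcases h x with h1 | h1
  · exact ⟨h1, by rwa [h1] at hx⟩
  · exfalso
    rcases h' (Ψ x) with h2 | h2
    · rw [hx] at h2; rw [← h2] at h1; exact lt_irrefl _ h1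
    · rw [hx] at h2; exact lt_asymm h1 h2

end IsIncreasingFor

section Move

variable {M E : Type*} [TopologicalSpace M] [T2Space M] [NormedAddCommGroup E]
  [InnerProductSpace ℝ E] [FiniteDimensional ℝ E]

/-- If `g` increases along the vector field `V` of a chart, then one small step along a cut-off of
`V` gives a homeomorphism that is increasing for `g`. -/
theorem exists_homeomorph_isIncreasingFor (φ : OpenPartialHomeomorph M E) {y₀ : E} {R δ : ℝ}
    (hR : 0 < R) (hδ : 0 < δ) (hball : Metric.closedBall y₀ R ⊆ φ.target) {V : E → E}
    (hV : ContDiff ℝ 1 V) {g : M → ℝ}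
    (hg : ∀ y ∈ Metric.ball y₀ R, V y ≠ 0 → ∀ t, 0 < t → t < δ →
      g (φ.symm y) < g (φ.symm (y + t • V y))) :
    ∃ Ψ : M ≃ₜ M, IsIncreasingFor g Ψ ∧ (∀ x ∉ φ.symm '' Metric.ball y₀ R, Ψ x = x) ∧
      (∀ y ∈ Metric.ball y₀ R, V y ≠ 0 → Ψ (φ.symm y) ≠ φ.symm y) ∧
      ∃ ε, 0 < ε ∧ ε < δ ∧ ∀ y ∈ Metric.closedBall y₀ (R / 2),
        Ψ (φ.symm y) = φ.symm (y + ε • V y) := by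
  -- The cut-off equals 1 on the half ball, so the step there is exactly `ε • V`; its being at most
  -- 1 elsewhere keeps every step below `δ`.
  let b : ContDiffBump y₀ := ⟨R / 2, R, by positivity, by linarith⟩
  have hsupp : Function.support (fun x => b x • V x) ⊆ Metric.ball y₀ R := by
    refine (Function.support_smul_subset_left _ _).trans ?_
    rw [b.support_eq]
  have hcs : HasCompactSupport (fun x => b x • V x) := b.hasCompactSupport.smul_right
  obtain ⟨ε, hε0, hεδ, h, hh⟩ := exists_homeomorph_add_smul
    (W := fun x => b x • V x) (b.contDiff.smul hV) hcs hδ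
  have hid : ∀ y ∉ Metric.closedBall y₀ R, h y = y := fun y hy => by
    have : b y • V y = 0 := by
      by_contra hne
      exact hy (Metric.ball_subset_closedBall (hsupp hne))
    rw [hh, this, smul_zero, add_zero]
  have hid' : ∀ y ∉ Metric.ball y₀ R, h y = y := fun y hy => by
    have : b y • V y = 0 := by
      by_contra hne
      exact hy (hsupp hne)
    rw [hh, this, smul_zero, add_zero]
  have happ : ∀ y ∈ Metric.ball y₀ R, φ.conjExtend h (φ.symm y) = φ.symm (h y) := fun y hy =>
    OpenPartialHomeomorph.conjExtend_symm_apply (hball (Metric.ball_subset_closedBall hy))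
  have hmove : ∀ y ∈ Metric.ball y₀ R, V y ≠ 0 →
      g (φ.symm y) < g (φ.conjExtend h (φ.symm y)) := fun y hy hVy => by
    have hb0 : 0 < b y := by
      have : y ∈ Function.support b := by rw [b.support_eq]; exact hy
      exact lt_of_le_of_ne b.nonneg (Ne.symm this)
    rw [happ y hy, hh, smul_smul]
    refine hg y hy hVy _ (by positivity) ?_
    calc ε * b y ≤ ε * 1 := by gcongr; exact b.le_one
      _ < δ := by linarith
  refine ⟨φ.conjHomeomorph h (isCompact_closedBall y₀ R) hball hid, ?_, ?_, ?_,
    ε, hε0, hεδ, ?_⟩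
  · intro x
    rw [OpenPartialHomeomorph.coe_conjHomeomorph]
    by_cases hx : x ∈ φ.symm '' Metric.ball y₀ R
    · obtain ⟨y, hy, rfl⟩ := hx
      by_cases hVy : V y = 0
      · left
        rw [happ y hy, hh, hVy, smul_zero, smul_zero, add_zero]
      · exact Or.inr (hmove y hy hVy)
    · exact Or.inl (OpenPartialHomeomorph.conjExtend_of_notMem hid' hx)
  · intro x hx
    exact OpenPartialHomeomorph.conjExtend_of_notMem hid' hx
  · intro y hy hVy heq
    have := hmove y hy hVy
    rw [OpenPartialHomeomorph.coe_conjHomeomorph] at heq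
    rw [heq] at this
    exact lt_irrefl _ this
  · intro y hy
    have hyR : y ∈ Metric.ball y₀ R := Metric.closedBall_subset_ball (by linarith) hy
    have hb1 : b y = 1 := b.one_of_mem_closedBall hy
    rw [OpenPartialHomeomorph.coe_conjHomeomorph, happ y hyR, hh, hb1, one_smul]

end Move

/-! ### The basin of attraction of a linear contraction -/

theorem Homeomorph.map_iterate_nhds {X : Type*} [TopologicalSpace X] (Θ : X ≃ₜ X) (k : ℕ) (x : X) :
    Filter.map Θ^[k] (𝓝 x) = 𝓝 (Θ^[k] x) := by
  induction k generalizing x with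
  | zero => simp
  | succ k ih => rw [Function.iterate_succ, ← Filter.map_map, Θ.map_nhds_eq, ih]; rfl

section Basin

variable {M E : Type*} [TopologicalSpace M] [NormedAddCommGroup E] [NormedSpace ℝ E]

/-- If `Φ` is an increasing homeomorphism for `g` of a compact space whose only fixed points are
`xmin` and `xmax`, then each forward orbit off `xmin` accumulates at `xmax`. -/
theorem IsIncreasingFor.exists_iterate_mem [CompactSpace M] {g : M → ℝ} (hg : Continuous g)
    {Φ : M → M} (hΦc : Continuous Φ) (hΦ : IsIncreasingFor g Φ) {xmin xmax : M}
    (hfix : ∀ x, Φ x = x → x = xmin ∨ x = xmax) (hmin : ∀ x, x ≠ xmin → g xmin < g x)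
    {U : Set M} (hU : U ∈ 𝓝 xmax) {x : M} (hx : x ≠ xmin) : ∃ k, Φ^[k] x ∈ U := by
  have hle : ∀ z, g z ≤ g (Φ z) := fun z => by
    rcases hΦ z with h | h
    · rw [h]
    · exact h.le
  have hmono : Monotone fun k => g (Φ^[k] x) := monotone_nat_of_le_succ fun k => by
    rw [Function.iterate_succ_apply']
    exact hle _
  obtain ⟨C, hC⟩ := (isCompact_range hg).bddAbove
  have hlim := tendsto_atTop_ciSup hmono ⟨C, by rintro _ ⟨k, rfl⟩; exact hC ⟨_, rfl⟩⟩
  set L := ⨆ k, g (Φ^[k] x)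
  obtain ⟨y, hy⟩ := exists_clusterPt_of_compactSpace (Filter.map (fun k => Φ^[k] x) Filter.atTop)
  have hy1 : MapClusterPt y Filter.atTop (fun k => Φ^[k] x) := hy
  -- Applied to `g` and to `g ∘ Φ`, which have the same limit along the orbit: `Φ` does not raise
  -- `g` at the cluster point, which is therefore fixed.
  have hval : ∀ G : M → ℝ, Continuous G →
      Filter.Tendsto (fun k => G (Φ^[k] x)) Filter.atTop (𝓝 L) → G y = L := fun G hG hlim => by
    have h1 : MapClusterPt (G y) Filter.atTop (G ∘ fun k => Φ^[k] x) :=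
      hy1.continuousAt_comp hG.continuousAt
    have h2 : ClusterPt (G y) (𝓝 L) := ClusterPt.mono h1 hlim
    exact eq_of_nhds_neBot h2
  have hgy : g y = L := hval g hg hlim
  have hgΦ : g (Φ y) = L := by
    refine hval (g ∘ Φ) (hg.comp hΦc) ?_
    have := hlim.comp (Filter.tendsto_add_atTop_nat 1)
    refine this.congr fun k => ?_
    simp [Function.iterate_succ_apply']
  have hyfix : Φ y = y := (hΦ y).resolve_right fun h => by rw [hgy, hgΦ] at h; exact lt_irrefl _ h
  have hyne : y ≠ xmin := by
    rintro rfl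
    have h0 : g x ≤ L := hmono.ge_of_tendsto hlim 0
    have := hmin x hx
    linarith
  have hyeq : y = xmax := (hfix y hyfix).resolve_left hyne
  subst hyeq
  exact (hy1.frequently hU).exists

/-- The basin of attraction of a linear contraction is a copy of the model space. -/
theorem exists_isOpenEmbedding_of_contraction [CompactSpace M] {g : M → ℝ} (hg : Continuous g)
    {Φ : M ≃ₜ M} (hΦ : IsIncreasingFor g Φ) {xmin xmax : M} (hne : xmax ≠ xmin)
    (hfix : ∀ x, Φ x = x → x = xmin ∨ x = xmax) (hxmin : Φ xmin = xmin)
    (hmin : ∀ x, x ≠ xmin → g xmin < g x) (φ : OpenPartialHomeomorph M E)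
    (hs : xmax ∈ φ.source) (h0 : φ xmax = 0) {R c : ℝ} (hR : 0 < R) (hc0 : 0 < c) (hc1 : c < 1)
    (hball : Metric.closedBall 0 R ⊆ φ.target)
    (hlin : ∀ y ∈ Metric.closedBall 0 R, Φ (φ.symm y) = φ.symm (c • y)) :
    ∃ j : E → M, Topology.IsOpenEmbedding j ∧ Set.range j = {xmin}ᶜ := by
  classical
  -- The linearization is extended outwards: shrink `v` into the ball by `k` contractions, then undo
  -- them in `M`. Once `c ^ k • v` is in the ball, larger `k` give the same point.
  let κ : ℕ → E → M := fun k v => Φ.symm^[k] (φ.symm (c ^ k • v))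
  have hnorm : ∀ (k : ℕ) (v : E), ‖c ^ k • v‖ = c ^ k * ‖v‖ := fun k v => by
    rw [norm_smul, Real.norm_of_nonneg (by positivity)]
  have hκ : ∀ (k m : ℕ) (v : E), ‖c ^ k • v‖ < R → k ≤ m → κ m v = κ k v := by
    intro k m v hk hm
    induction m, hm using Nat.le_induction with
    | base => rfl
    | succ m hm ih =>
      rw [← ih]
      have hmem : c ^ m • v ∈ Metric.closedBall (0 : E) R := by
        rw [mem_closedBall_zero_iff, hnorm]
        rw [hnorm] at hk
        have : c ^ m ≤ c ^ k := pow_le_pow_of_le_one hc0.le hc1.le hm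
        nlinarith [norm_nonneg v]
      have h1 := hlin _ hmem
      rw [smul_smul, ← pow_succ'] at h1
      simp only [κ]
      rw [Function.iterate_succ_apply, ← h1, Homeomorph.symm_apply_apply]
  have hex : ∀ v : E, ∃ k : ℕ, ‖c ^ k • v‖ < R := fun v => by
    have h1 : Filter.Tendsto (fun k : ℕ => c ^ k * ‖v‖) Filter.atTop (𝓝 (0 * ‖v‖)) :=
      (tendsto_pow_atTop_nhds_zero_of_lt_one hc0.le hc1).mul_const _
    rw [zero_mul] at h1
    obtain ⟨k, hk⟩ := (h1.eventually_lt_const hR).exists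
    exact ⟨k, by rwa [hnorm]⟩
  let j : E → M := fun v => κ (Nat.find (hex v)) v
  have hj : ∀ (k : ℕ) (v : E), ‖c ^ k • v‖ < R → j v = κ k v := fun k v hk =>
    (hκ _ k v (Nat.find_spec (hex v)) (Nat.find_min' _ hk)).symm
  have hmemt : ∀ {y : E}, ‖y‖ < R → y ∈ φ.target := fun hy =>
    hball (mem_closedBall_zero_iff.2 hy.le)
  -- One equality of filters yields both continuity and openness, since `j` is locally a composite
  -- of homeomorphisms.
  have hmap : ∀ v, Filter.map j (𝓝 v) = 𝓝 (j v) := fun v => by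
    obtain ⟨k, hk⟩ := hex v
    have hev : ∀ᶠ w in 𝓝 v, ‖c ^ k • w‖ < R := by
      have : Continuous fun w : E => ‖c ^ k • w‖ := by fun_prop
      exact this.continuousAt.eventually_lt_const hk
    have h1 : j =ᶠ[𝓝 v] κ k := hev.mono fun w hw => hj k w hw
    have hck : c ^ k ≠ 0 := by positivity
    have h2 : Filter.map (fun w : E => c ^ k • w) (𝓝 v) = 𝓝 (c ^ k • v) :=
      (Homeomorph.smulOfNeZero (c ^ k) hck).map_nhds_eq v
    have h3 : Filter.map φ.symm (𝓝 (c ^ k • v)) = 𝓝 (φ.symm (c ^ k • v)) :=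
      φ.symm.map_nhds_eq (hmemt hk)
    rw [Filter.map_congr h1, h1.eq_of_nhds]
    change Filter.map (Φ.symm^[k] ∘ φ.symm ∘ fun w => c ^ k • w) (𝓝 v) = _
    rw [← Filter.map_map, ← Filter.map_map, h2, h3, Homeomorph.map_iterate_nhds]
  have hinj : Function.Injective j := fun v w hvw => by
    obtain ⟨k, hk⟩ := hex v
    obtain ⟨l, hl⟩ := hex w
    have hmono : ∀ {a b : ℕ} {u : E}, a ≤ b → ‖c ^ a • u‖ < R → ‖c ^ b • u‖ < R := by
      intro a b u hab h
      rw [hnorm] at h ⊢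
      have : c ^ b ≤ c ^ a := pow_le_pow_of_le_one hc0.le hc1.le hab
      nlinarith [norm_nonneg u]
    have hv := hmono (le_max_left k l) hk
    have hw := hmono (le_max_right k l) hl
    rw [hj _ v hv, hj _ w hw] at hvw
    have h1 := Φ.symm.injective.iterate _ hvw
    have h2 := φ.symm.injOn (hmemt hv) (hmemt hw) h1
    exact smul_right_injective E (by positivity : c ^ (max k l) ≠ 0) h2
  have hiter : ∀ k : ℕ, Φ^[k] xmin = xmin := fun k => Function.iterate_fixed hxmin k
  have hΦiter : ∀ (k : ℕ) (z : M), Φ^[k] (Φ.symm^[k] z) = z := fun k z =>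
    (Function.RightInverse.iterate Φ.apply_symm_apply k) z
  have hiterΦ : ∀ (k : ℕ) (z : M), Φ.symm^[k] (Φ^[k] z) = z := fun k z =>
    (Function.LeftInverse.iterate Φ.symm_apply_apply k) z
  refine ⟨j, .of_continuous_injective_isOpenMap ?_ hinj ?_, ?_⟩
  · exact continuous_iff_continuousAt.2 fun v => (hmap v).le
  · exact IsOpenMap.of_nhds_le fun v => (hmap v).ge
  · ext x
    constructor
    · rintro ⟨v, rfl⟩ heq
      obtain ⟨k, hk⟩ := hex v
      rw [Set.mem_singleton_iff, hj k v hk] at heq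
      -- The point `xmin` would be a fixed point inside the contracted ball, that is, its centre
      -- `xmax`.
      have h1 : φ.symm (c ^ k • v) = xmin := by rw [← hiter k, ← heq, hΦiter]
      have h2 := hlin _ (mem_closedBall_zero_iff.2 hk.le)
      rw [h1, hxmin] at h2
      have hmem : ‖c • c ^ k • v‖ < R := by
        rw [norm_smul, Real.norm_of_nonneg hc0.le]
        nlinarith [norm_nonneg (c ^ k • v)]
      have h3 := φ.symm.injOn (hmemt hk) (hmemt hmem) (h1.trans h2)
      have h4 : (1 - c) • (c ^ k • v) = 0 := by
        rw [sub_smul, one_smul, sub_eq_zero]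
        exact h3
      have h5 : c ^ k • v = 0 := (smul_eq_zero.1 h4).resolve_left (by linarith)
      rw [h5, ← h0, φ.left_inv hs] at h1
      exact hne h1
    · intro hx
      have hU : φ.symm '' Metric.ball 0 R ∈ 𝓝 xmax := by
        have h1 : φ.source ∩ φ ⁻¹' Metric.ball 0 R ∈ 𝓝 xmax := by
          refine Filter.inter_mem (φ.open_source.mem_nhds hs) (φ.continuousAt hs ?_)
          rw [h0]
          exact Metric.ball_mem_nhds 0 hR
        refine Filter.mem_of_superset h1 ?_
        rintro z ⟨hz, hz'⟩
        exact ⟨φ z, hz', φ.left_inv hz⟩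
      obtain ⟨k, y, hy, hyk⟩ := hΦ.exists_iterate_mem hg Φ.continuous hfix hmin hU hx
      have hck : c ^ k ≠ 0 := by positivity
      have hy' : c ^ k • ((c ^ k)⁻¹ • y) = y := smul_inv_smul₀ hck y
      refine ⟨(c ^ k)⁻¹ • y, ?_⟩
      rw [hj k _ (by rw [hy']; exact mem_ball_zero_iff.1 hy)]
      simp only [κ]
      rw [hy', hyk, hiterΦ]

/-- A compact space with a point off which it is a copy of `ℝⁿ` is homeomorphic to `Sⁿ`. -/
theorem nonempty_homeomorph_sphere [CompactSpace M] [T2Space M] {n : ℕ} {x : M}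
    {j : EuclideanSpace ℝ (Fin n) → M} (hj : Topology.IsOpenEmbedding j)
    (hr : Set.range j = {x}ᶜ) :
    Nonempty (M ≃ₜ Metric.sphere (0 : EuclideanSpace ℝ (Fin (n + 1))) 1) :=
  ⟨(OnePoint.equivOfIsEmbeddingOfRangeEq x j hj.toIsEmbedding hr).symm.trans
    (onePointEquivSphereOfFinrankEq (by simp))⟩

end Basin

/-! ### Functions with two critical points -/

/-- The minimum is handled as a maximum of `-g`; inverting the contraction found there gives an
expansion that is increasing for `g`. -/
theorem IsIncreasingFor.symm_of_neg {M : Type*} [TopologicalSpace M] {g : M → ℝ} {Ψ : M ≃ₜ M}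
    (h : IsIncreasingFor (fun x => -g x) Ψ) : IsIncreasingFor g Ψ.symm := fun x => by
  rcases h (Ψ.symm x) with h1 | h1
  · left; rw [Ψ.apply_symm_apply] at h1; exact h1.symm
  · right; rw [Ψ.apply_symm_apply] at h1; linarith

/-- Along a direction in which its derivative is positive, a function increases. -/
theorem HasStrictFDerivAt.exists_forall_lt_add_smul {E : Type*} [NormedAddCommGroup E]
    [NormedSpace ℝ E] {G : E → ℝ} {G' : E →L[ℝ] ℝ} {y₀ w : E}
    (hG : HasStrictFDerivAt G G' y₀) (hw : 0 < G' w) :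
    ∃ r > 0, ∃ δ > 0, ∀ y ∈ Metric.ball y₀ r, ∀ t : ℝ, 0 < t → t < δ → G y < G (y + t • w) := by
  have hw0 : 0 < ‖w‖ := norm_pos_iff.2 fun h => by simp [h] at hw
  -- With this constant the error of the linear approximation is at most half the gain `t * G' w`.
  have hc : 0 < G' w / (2 * ‖w‖) := by positivity
  have h1 := hG.isLittleO.bound hc
  rw [nhds_prod_eq, Metric.nhds_basis_ball.prod_self.eventually_iff] at h1
  obtain ⟨r, hr, h1⟩ := h1
  refine ⟨r / 2, by positivity, r / (2 * ‖w‖), by positivity, fun y hy t ht htd => ?_⟩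
  rw [Metric.mem_ball, dist_eq_norm] at hy
  have htw : t * ‖w‖ < r / 2 := by
    rw [lt_div_iff₀ (by positivity)] at htd
    linarith
  have hnw : ‖t • w‖ = t * ‖w‖ := by rw [norm_smul, Real.norm_of_nonneg ht.le]
  have hy1 : y ∈ Metric.ball y₀ r := by
    rw [Metric.mem_ball, dist_eq_norm]; linarith
  have hy2 : y + t • w ∈ Metric.ball y₀ r := by
    rw [Metric.mem_ball, dist_eq_norm]
    calc ‖y + t • w - y₀‖ = ‖(y - y₀) + t • w‖ := by congr 1; abel
      _ ≤ ‖y - y₀‖ + ‖t • w‖ := norm_add_le _ _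
      _ < r := by rw [hnw]; linarith
  have h2 := @h1 (y + t • w, y) ⟨hy2, hy1⟩
  simp only [add_sub_cancel_left, map_smul, smul_eq_mul, hnw, Real.norm_eq_abs] at h2
  have h3 : G' w / (2 * ‖w‖) * (t * ‖w‖) = t * G' w / 2 := by field_simp
  rw [h3] at h2
  have h4 := (abs_le.1 h2).1
  have h5 : 0 < t * G' w := by positivity
  linarith

section TwoCriticalPoints

variable {M E : Type*} [TopologicalSpace M] [T2Space M] [NormedAddCommGroup E]
  [InnerProductSpace ℝ E] [FiniteDimensional ℝ E]

/-- Near a regular point of `g` some increasing homeomorphism moves all points. -/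
theorem exists_isIncreasingFor_of_regular {g : M → ℝ} {x : M} (φ : OpenPartialHomeomorph M E)
    (hx : x ∈ φ.source) {G' : E →L[ℝ] ℝ} (hG : HasStrictFDerivAt (g ∘ φ.symm) G' (φ x))
    (hG' : G' ≠ 0) {O : Set M} (hO : O ∈ 𝓝 x) :
    ∃ Ψ : M ≃ₜ M, IsIncreasingFor g Ψ ∧ (∀ z ∉ O, Ψ z = z) ∧ ∀ᶠ z in 𝓝 x, Ψ z ≠ z := by
  obtain ⟨w, hw⟩ : ∃ w, 0 < G' w := by
    obtain ⟨w, hw⟩ : ∃ w, G' w ≠ 0 := by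
      by_contra! h
      exact hG' (ContinuousLinearMap.ext h)
    rcases lt_or_gt_of_ne hw with h | h
    · exact ⟨-w, by simpa using h⟩
    · exact ⟨w, h⟩
  have hw0 : w ≠ 0 := fun h => by simp [h] at hw
  obtain ⟨r, hr, δ, hδ, hinc⟩ := hG.exists_forall_lt_add_smul hw
  have hxt := φ.map_source hx
  have hnhds : φ.target ∩ φ.symm ⁻¹' O ∈ 𝓝 (φ x) := by
    refine Filter.inter_mem (φ.open_target.mem_nhds hxt) (φ.continuousAt_symm hxt ?_)
    rwa [φ.left_inv hx]
  obtain ⟨r', hr', hsub⟩ := Metric.nhds_basis_closedBall.mem_iff.1 hnhds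
  have hR : 0 < min r r' := lt_min hr hr'
  have hb : Metric.closedBall (φ x) (min r r') ⊆ φ.target ∩ φ.symm ⁻¹' O :=
    (Metric.closedBall_subset_closedBall (min_le_right _ _)).trans hsub
  obtain ⟨Ψ, hΨ, hid, hmove, -⟩ := exists_homeomorph_isIncreasingFor φ (V := fun _ => w) hR hδ
    (hb.trans Set.inter_subset_left) contDiff_const (g := g) fun y hy _ t ht htd =>
      hinc y (Metric.ball_subset_ball (min_le_left _ _) hy) t ht htd
  refine ⟨Ψ, hΨ, fun z hz => hid z ?_, ?_⟩
  · rintro ⟨y, hy, rfl⟩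
    exact hz (hb (Metric.ball_subset_closedBall hy)).2
  · filter_upwards [φ.open_source.mem_nhds hx,
      φ.continuousAt hx (Metric.ball_mem_nhds _ hR)] with z hz hz'
    have := hmove (φ z) hz' hw0
    rwa [φ.left_inv hz] at this

/-- Near a point from which `g` decreases along all rays of a chart, there is an increasing
homeomorphism that is a linear contraction around that point. -/
theorem exists_isIncreasingFor_contraction {g : M → ℝ} {x : M} (φ : OpenPartialHomeomorph M E)
    (hx : x ∈ φ.source) (h0 : φ x = 0) {r : ℝ} (hr : 0 < r)
    (hg : ∀ y, ‖y‖ < r → y ≠ 0 → ∀ t : ℝ, 0 < t → t < 1 → g (φ.symm y) < g (φ.symm ((1 - t) • y)))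
    {O : Set M} (hO : O ∈ 𝓝 x) :
    ∃ Ψ : M ≃ₜ M, IsIncreasingFor g Ψ ∧ (∀ z ∉ O, Ψ z = z) ∧ ∃ R > 0,
      Metric.closedBall 0 (2 * R) ⊆ φ.target ∩ φ.symm ⁻¹' O ∧
      (∀ y ∈ Metric.ball 0 (2 * R), y ≠ 0 → Ψ (φ.symm y) ≠ φ.symm y) ∧
      ∃ c : ℝ, 0 < c ∧ c < 1 ∧ ∀ y ∈ Metric.closedBall 0 R, Ψ (φ.symm y) = φ.symm (c • y) := by
  have hxt := φ.map_source hx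
  have hnhds : φ.target ∩ φ.symm ⁻¹' O ∈ 𝓝 (φ x) := by
    refine Filter.inter_mem (φ.open_target.mem_nhds hxt) (φ.continuousAt_symm hxt ?_)
    rwa [φ.left_inv hx]
  rw [h0] at hnhds
  obtain ⟨r', hr', hsub⟩ := Metric.nhds_basis_closedBall.mem_iff.1 hnhds
  have hR : 0 < min r r' := lt_min hr hr'
  have hb : Metric.closedBall (0 : E) (min r r') ⊆ φ.target ∩ φ.symm ⁻¹' O :=
    (Metric.closedBall_subset_closedBall (min_le_right _ _)).trans hsub
  have hV : ∀ (t : ℝ) (y : E), y + t • (-y) = (1 - t) • y := fun t y => by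
    rw [sub_smul, one_smul, smul_neg, sub_eq_add_neg]
  obtain ⟨Ψ, hΨ, hid, hmove, ε, hε0, hε1, hlin⟩ :=
    exists_homeomorph_isIncreasingFor φ (V := fun y => -y) hR one_pos
    (hb.trans Set.inter_subset_left) contDiff_neg (g := g) fun y hy hy0 t ht ht1 => by
      rw [hV]
      refine hg y ?_ (neg_ne_zero.1 hy0) t ht ht1
      exact (mem_ball_zero_iff.1 hy).trans_le (min_le_left _ _)
  have h2 : 2 * (min r r' / 2) = min r r' := by ring
  refine ⟨Ψ, hΨ, fun z hz => hid z ?_, min r r' / 2, by positivity, by rwa [h2], ?_,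
    1 - ε, by linarith, by linarith, fun y hy => ?_⟩
  · rintro ⟨y, hy, rfl⟩
    exact hz (hb (Metric.ball_subset_closedBall hy)).2
  · rw [h2]
    exact fun y hy hy0 => hmove y hy (neg_ne_zero.2 hy0)
  · rw [hlin y hy, hV]

/-- If all points of a compact set are regular, then some increasing homeomorphism moves them. -/
theorem exists_isIncreasingFor_of_isCompact {g : M → ℝ} {K O : Set M} (hK : IsCompact K)
    (hO : ∀ x ∈ K, O ∈ 𝓝 x)
    (hreg : ∀ x ∈ K, ∃ φ : OpenPartialHomeomorph M E, x ∈ φ.source ∧ ∃ G' : E →L[ℝ] ℝ,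
      HasStrictFDerivAt (g ∘ φ.symm) G' (φ x) ∧ G' ≠ 0) :
    ∃ Ψ : M ≃ₜ M, IsIncreasingFor g Ψ ∧ (∀ z ∉ O, Ψ z = z) ∧ ∀ z ∈ K, Ψ z ≠ z := by
  refine hK.induction_on (p := fun S => ∃ Ψ : M ≃ₜ M, IsIncreasingFor g Ψ ∧
    (∀ z ∉ O, Ψ z = z) ∧ ∀ z ∈ S, Ψ z ≠ z) ?_ ?_ ?_ ?_
  · exact ⟨Homeomorph.refl M, fun x => Or.inl rfl, fun z _ => rfl, fun z hz => hz.elim⟩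
  · rintro s t hst ⟨Ψ, h1, h2, h3⟩
    exact ⟨Ψ, h1, h2, fun z hz => h3 z (hst hz)⟩
  · rintro s t ⟨Ψ, h1, h2, h3⟩ ⟨Ψ', h1', h2', h3'⟩
    refine ⟨Ψ.trans Ψ', h1'.comp h1, fun z hz => ?_, fun z hz heq => ?_⟩
    · rw [Homeomorph.trans_apply, h2 z hz, h2' z hz]
    · obtain ⟨h4, h5⟩ := h1'.comp_eq_self h1 heq
      rcases hz with hz | hz
      · exact h3 z hz h4
      · exact h3' z hz h5
  · intro x hx
    obtain ⟨φ, hxs, G', hG, hG'⟩ := hreg x hx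
    obtain ⟨Ψ, h1, h2, h3⟩ := exists_isIncreasingFor_of_regular φ hxs hG hG' (hO x hx)
    exact ⟨_, mem_nhdsWithin_of_mem_nhds h3, Ψ, h1, h2, fun z hz => hz⟩

/-- **Reeb's sphere theorem**: a compact space with a function whose only critical points are a
minimum and a maximum that are radial in some charts is a copy of `ℝⁿ` off the minimum. -/
theorem exists_isOpenEmbedding_of_two_critical_points [CompactSpace M] {g : M → ℝ}
    (hg : Continuous g) {xmin xmax : M} (hne : xmax ≠ xmin)
    (hmin : ∀ x, x ≠ xmin → g xmin < g x)
    (hreg : ∀ x, x ≠ xmin → x ≠ xmax → ∃ φ : OpenPartialHomeomorph M E, x ∈ φ.source ∧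
      ∃ G' : E →L[ℝ] ℝ, HasStrictFDerivAt (g ∘ φ.symm) G' (φ x) ∧ G' ≠ 0)
    (φ : OpenPartialHomeomorph M E) (hx : xmax ∈ φ.source) (h0 : φ xmax = 0) {r : ℝ} (hr : 0 < r)
    (hφ : ∀ y, ‖y‖ < r → y ≠ 0 → ∀ t : ℝ, 0 < t → t < 1 → g (φ.symm y) < g (φ.symm ((1 - t) • y)))
    (φ' : OpenPartialHomeomorph M E) (hx' : xmin ∈ φ'.source) (h0' : φ' xmin = 0) {r' : ℝ}
    (hr' : 0 < r')
    (hφ' : ∀ y, ‖y‖ < r' → y ≠ 0 → ∀ t : ℝ, 0 < t → t < 1 →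
      g (φ'.symm ((1 - t) • y)) < g (φ'.symm y)) :
    ∃ j : E → M, Topology.IsOpenEmbedding j ∧ Set.range j = {xmin}ᶜ := by
  -- The supports are nested with care: `Ψ` avoids `xmin`, while `Ψ'` and later `Θ` avoid the closed
  -- ball on which `Ψ` is linear. The composite is then still that linear contraction near `xmax`.
  obtain ⟨Ψ, hΨ, hid, R, hR, hball, hmove, c, hc0, hc1, hlin⟩ :=
    exists_isIncreasingFor_contraction φ hx h0 hr hφ (O := {xmin}ᶜ)
      (isOpen_compl_singleton.mem_nhds hne)
  have hRR : Metric.closedBall (0 : E) R ⊆ Metric.closedBall 0 (2 * R) :=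
    Metric.closedBall_subset_closedBall (by linarith)
  have hRR' : Metric.closedBall (0 : E) R ⊆ Metric.ball 0 (2 * R) :=
    Metric.closedBall_subset_ball (by linarith)
  have hBc : IsClosed (φ.symm '' Metric.closedBall 0 R) :=
    ((isCompact_closedBall 0 R).image_of_continuousOn (φ.continuousOn_symm.mono
      fun y hy => (hball (hRR hy)).1)).isClosed
  have hxminB : xmin ∉ φ.symm '' Metric.closedBall 0 R := by
    rintro ⟨y, hy, hy'⟩
    exact (hball (hRR hy)).2 hy'
  obtain ⟨Ψ', hΨ', hid', R', hR', hball', hmove', c', -, -, hlin'⟩ :=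
    exists_isIncreasingFor_contraction (g := fun x => -g x) φ' hx' h0' hr'
      (fun y hy hy0 t ht ht1 => neg_lt_neg (hφ' y hy hy0 t ht ht1))
      (hBc.isOpen_compl.mem_nhds hxminB)
  have hopen : IsOpen (φ.symm '' Metric.ball 0 (2 * R)) :=
    φ.symm.isOpen_image_of_subset_source Metric.isOpen_ball
      fun y hy => (hball (Metric.ball_subset_closedBall hy)).1
  have hopen' : IsOpen (φ'.symm '' Metric.ball 0 (2 * R')) :=
    φ'.symm.isOpen_image_of_subset_source Metric.isOpen_ball
      fun y hy => (hball' (Metric.ball_subset_closedBall hy)).1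
  have hsymm0 : φ.symm 0 = xmax := by rw [← h0, φ.left_inv hx]
  have hsymm0' : φ'.symm 0 = xmin := by rw [← h0', φ'.left_inv hx']
  set K := (φ.symm '' Metric.ball 0 (2 * R) ∪ φ'.symm '' Metric.ball 0 (2 * R'))ᶜ with hKdef
  have hK : IsCompact K := (hopen.union hopen').isClosed_compl.isCompact
  have hxminK : ∀ x ∈ K, x ≠ xmin := by
    rintro _ hxK rfl
    exact hxK (Or.inr ⟨0, Metric.mem_ball_self (by positivity), hsymm0'⟩)
  have hxmaxK : ∀ x ∈ K, x ≠ xmax := by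
    rintro _ hxK rfl
    exact hxK (Or.inl ⟨0, Metric.mem_ball_self (by positivity), hsymm0⟩)
  obtain ⟨Θ, hΘ, hidΘ, hmoveΘ⟩ := exists_isIncreasingFor_of_isCompact (g := g)
    (O := (φ.symm '' Metric.closedBall 0 R ∪ {xmin})ᶜ) hK
    (fun x hx => (hBc.union isClosed_singleton).isOpen_compl.mem_nhds (by
      rintro (⟨y, hy, rfl⟩ | h)
      · exact hx (Or.inl ⟨y, hRR' hy, rfl⟩)
      · exact hxminK x hx h))
    (fun x hx => hreg x (hxminK x hx) (hxmaxK x hx))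
  have hΨ'min : Ψ'.symm xmin = xmin := by
    rw [Homeomorph.symm_apply_eq]
    have := hlin' 0 (Metric.mem_closedBall_self hR'.le)
    rw [smul_zero, hsymm0'] at this
    exact this.symm
  have hΨs := hΨ'.symm_of_neg
  -- A fixed point of the composite is fixed by every factor. `Θ` excludes all of `K`, and in the
  -- two balls making up its complement `Ψ` and `Ψ'` exclude all but the centres.
  refine exists_isOpenEmbedding_of_contraction hg (Φ := Θ.trans (Ψ'.symm.trans Ψ)) (xmax := xmax)
    (hΨ.comp (hΨs.comp hΘ)) hne ?_ ?_ hmin φ hx h0 hR hc0 hc1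
    (fun y hy => (hball (hRR hy)).1) ?_
  · intro x hfix
    obtain ⟨h1, h2⟩ := hΨ.comp_eq_self (hΨs.comp hΘ) hfix
    obtain ⟨h3, h4⟩ := hΨs.comp_eq_self hΘ h1
    have hxK : x ∉ K := fun h => hmoveΘ x h h3
    rw [hKdef, Set.notMem_compl_iff] at hxK
    rcases hxK with ⟨y, hy, rfl⟩ | ⟨y, hy, rfl⟩
    · right
      by_contra hyne
      exact hmove y hy (fun h => hyne (by rw [h, hsymm0])) h2
    · left
      by_contra hyne
      refine hmove' y hy (fun h => hyne (by rw [h, hsymm0'])) ?_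
      rw [Homeomorph.symm_apply_eq] at h4
      exact h4.symm
  · simp only [Homeomorph.trans_apply]
    rw [hidΘ xmin (by simp), hΨ'min]
    exact hid xmin (by simp)
  · intro y hy
    have hyB : φ.symm y ∈ φ.symm '' Metric.closedBall 0 R := ⟨y, hy, rfl⟩
    simp only [Homeomorph.trans_apply]
    have h1 : Ψ'.symm (φ.symm y) = φ.symm y := by
      rw [Homeomorph.symm_apply_eq, hid' _ (by simpa using hyB)]
    rw [hidΘ _ (fun h => h (Or.inl hyB)), h1, hlin y hy]

end TwoCriticalPoints

/-! ### Nondegenerate maxima -/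

section SecondDerivative

variable {E V : Type*} [NormedAddCommGroup E] [NormedSpace ℝ E]
  [NormedAddCommGroup V] [InnerProductSpace ℝ V]

/-- Near a nondegenerate maximum, a function decreases along rays. -/
theorem exists_radial_of_fderiv_fderiv_neg [FiniteDimensional ℝ E] {G : E → ℝ}
    (hG : ContDiffAt ℝ 2 G 0) (h1 : fderiv ℝ G 0 = 0)
    (h2 : ∀ w, w ≠ 0 → fderiv ℝ (fderiv ℝ G) 0 w w < 0) :
    ∃ r > 0, ∀ y, ‖y‖ < r → y ≠ 0 → ∀ t : ℝ, 0 < t → t < 1 → G y < G ((1 - t) • y) := by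
  set B := fderiv ℝ (fderiv ℝ G) 0
  obtain ⟨c, hc, hB⟩ : ∃ c > 0, ∀ w, B w w ≤ -c * ‖w‖ ^ 2 := by
    rcases subsingleton_or_nontrivial E with h | h
    · exact ⟨1, one_pos, fun w => by simp [Subsingleton.elim w 0]⟩
    · have hcont : Continuous fun w => B w w := by fun_prop
      obtain ⟨w₀, hw₀, hmax⟩ := (isCompact_sphere (0 : E) 1).exists_isMaxOn
        (NormedSpace.sphere_nonempty.2 zero_le_one) hcont.continuousOn
      have hw₀' : w₀ ≠ 0 := by
        rintro rfl
        simp at hw₀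
      refine ⟨-B w₀ w₀, by linarith [h2 w₀ hw₀'], fun w => ?_⟩
      rcases eq_or_ne w 0 with rfl | hw
      · simp
      have hn : ‖w‖ ≠ 0 := norm_ne_zero_iff.2 hw
      have hmem : ‖w‖⁻¹ • w ∈ Metric.sphere (0 : E) 1 := by
        simp [norm_smul, hn]
      have h3 : B (‖w‖⁻¹ • w) (‖w‖⁻¹ • w) ≤ B w₀ w₀ := hmax hmem
      simp only [map_smul, smul_apply, smul_eq_mul] at h3
      have h4 : B w w = (‖w‖⁻¹ * (‖w‖⁻¹ * B w w)) * ‖w‖ ^ 2 := by field_simp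
      rw [h4, neg_neg]
      gcongr
  have hd1 : ContDiffAt ℝ 1 (fderiv ℝ G) 0 := hG.fderiv_right (by norm_num)
  have hd : HasFDerivAt (fderiv ℝ G) B 0 := (hd1.differentiableAt one_ne_zero).hasFDerivAt
  have hlo := hd.isLittleO.bound (half_pos hc)
  have hdiff : ∀ᶠ y in 𝓝 (0 : E), DifferentiableAt ℝ G y :=
    (hG.eventually (by simp)).mono fun y hy => hy.differentiableAt (by norm_num)
  obtain ⟨r, hr, hball⟩ := Metric.eventually_nhds_iff_ball.1 (hlo.and hdiff)
  refine ⟨r, hr, fun y hy hy0 t ht ht1 => ?_⟩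
  -- The gradient is `B z` up to an error of `c / 2 * ‖z‖`, so the radial derivative is at most `-(c
  -- / 2) * ‖z‖ ^ 2`.
  have hneg : ∀ z : E, ‖z‖ < r → z ≠ 0 → fderiv ℝ G z z < 0 := fun z hz hz0 => by
    have h3 := (hball z (mem_ball_zero_iff.2 hz)).1
    rw [h1, sub_zero, sub_zero] at h3
    have h4 : ‖(fderiv ℝ G z - B z) z‖ ≤ c / 2 * ‖z‖ * ‖z‖ :=
      (ContinuousLinearMap.le_opNorm _ _).trans (by gcongr)
    have h5 := (abs_le.1 h4).2
    rw [sub_apply] at h5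
    have h6 := hB z
    have h7 : 0 < ‖z‖ ^ 2 := by positivity
    nlinarith
  have hsm : ∀ s : ℝ, 0 < s → s ≤ 1 → ‖s • y‖ < r := fun s hs hs1 => by
    rw [norm_smul, Real.norm_of_nonneg hs.le]
    nlinarith [norm_nonneg y]
  have hder : ∀ s : ℝ, 0 < s → s ≤ 1 → HasDerivAt (fun s : ℝ => G (s • y)) (fderiv ℝ G (s • y) y) s :=
    fun s hs hs1 => by
      have h3 := (hball _ (mem_ball_zero_iff.2 (hsm s hs hs1))).2.hasFDerivAt
      have h4 : HasDerivAt (fun s : ℝ => s • y) y s := by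
        simpa using (hasDerivAt_id s).smul_const y
      exact h3.comp_hasDerivAt s h4
  have hanti : StrictAntiOn (fun s : ℝ => G (s • y)) (Set.Icc (1 - t) 1) := by
    refine strictAntiOn_of_deriv_neg (convex_Icc _ _)
      (fun s hs => (hder s (by linarith [hs.1]) hs.2).continuousAt.continuousWithinAt) fun s hs => ?_
    rw [interior_Icc] at hs
    have hs0 : 0 < s := by linarith [hs.1]
    rw [(hder s hs0 hs.2.le).deriv]
    have h3 := hneg (s • y) (hsm s hs0 hs.2.le) (smul_ne_zero hs0.ne' hy0)
    rw [map_smul, smul_eq_mul] at h3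
    exact neg_of_mul_neg_right h3 hs0.le
  have := hanti (Set.left_mem_Icc.2 (by linarith)) (Set.right_mem_Icc.2 (by linarith))
    (by linarith : 1 - t < 1)
  simpa using this

/-- A positive second derivative would make the point a local minimum as well, so `k` would be
locally constant and its second derivative zero. -/
theorem IsLocalMax.deriv_deriv_nonpos {k : ℝ → ℝ} {t : ℝ} (h : IsLocalMax k t)
    (hc : ContinuousAt k t) : deriv (deriv k) t ≤ 0 := by
  by_contra! hpos
  have hmin := isLocalMin_of_deriv_deriv_pos hpos h.deriv_eq_zero hc
  have hconst : k =ᶠ[𝓝 t] fun _ => k t := by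
    filter_upwards [h, hmin] with s h1 h2 using le_antisymm h1 h2
  have h1 : deriv (deriv k) t = 0 := by
    rw [hconst.deriv.deriv_eq]
    simp
  linarith

theorem ContDiffAt.eventually_hasDerivAt_line {F : E → V} (hF : ContDiffAt ℝ 2 F 0) (w : E) :
    ∀ᶠ t : ℝ in 𝓝 0, HasDerivAt (fun t : ℝ => F (t • w)) (fderiv ℝ F (t • w) w) t := by
  have hdiff : ∀ᶠ y in 𝓝 (0 : E), DifferentiableAt ℝ F y :=
    (hF.eventually (by simp)).mono fun y hy => hy.differentiableAt (by norm_num)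
  have htend : Filter.Tendsto (fun t : ℝ => t • w) (𝓝 0) (𝓝 0) := by
    have : Continuous fun t : ℝ => t • w := by fun_prop
    simpa using this.tendsto 0
  filter_upwards [htend.eventually hdiff] with t ht
  have h4 : HasDerivAt (fun s : ℝ => s • w) w t := by
    simpa using (hasDerivAt_id t).smul_const w
  exact ht.hasFDerivAt.comp_hasDerivAt t h4

theorem ContDiffAt.hasDerivAt_fderiv_line {F : E → V} (hF : ContDiffAt ℝ 2 F 0) (w : E) :
    HasDerivAt (fun t : ℝ => fderiv ℝ F (t • w) w) (fderiv ℝ (fderiv ℝ F) 0 w w) 0 := by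
  have hd1 : ContDiffAt ℝ 1 (fderiv ℝ F) 0 := hF.fderiv_right (by norm_num)
  have h0 : HasFDerivAt (fderiv ℝ F) (fderiv ℝ (fderiv ℝ F) 0) ((0 : ℝ) • w) := by
    rw [zero_smul]
    exact (hd1.differentiableAt one_ne_zero).hasFDerivAt
  have h4 : HasDerivAt (fun s : ℝ => s • w) w 0 := by
    simpa using (hasDerivAt_id (0 : ℝ)).smul_const w
  have h5 : HasDerivAt (fun t : ℝ => fderiv ℝ F (t • w)) (fderiv ℝ (fderiv ℝ F) 0 w) 0 :=
    h0.comp_hasDerivAt (0 : ℝ) h4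
  have h6 := h5.clm_apply (hasDerivAt_const (0 : ℝ) w)
  simp only [map_zero, add_zero] at h6
  exact h6

/-- A map into the unit ball with a value on the sphere: first and second order conditions. -/
theorem inner_fderiv_of_norm_le_one {F : E → V} (hF : ContDiffAt ℝ 2 F 0) (h1 : ‖F 0‖ = 1)
    (hle : ∀ᶠ y in 𝓝 (0 : E), ‖F y‖ ≤ 1)
    (w : E) : inner ℝ (F 0) (fderiv ℝ F 0 w) = 0 ∧
      inner ℝ (F 0) (fderiv ℝ (fderiv ℝ F) 0 w w) + ‖fderiv ℝ F 0 w‖ ^ 2 ≤ 0 := by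
  set γ : ℝ → V := fun t => F (t • w) with hγ
  have hγ0 : γ 0 = F 0 := by simp [hγ]
  have hev := hF.eventually_hasDerivAt_line w
  have hk : ∀ᶠ t : ℝ in 𝓝 0, HasDerivAt (fun t => ‖γ t‖ ^ 2)
      (2 * inner ℝ (γ t) (fderiv ℝ F (t • w) w)) t := hev.mono fun t ht => ht.norm_sq
  have htend : Filter.Tendsto (fun t : ℝ => t • w) (𝓝 0) (𝓝 0) := by
    have : Continuous fun t : ℝ => t • w := by fun_prop
    simpa using this.tendsto 0
  have hmax : IsLocalMax (fun t => ‖γ t‖ ^ 2) 0 := by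
    filter_upwards [htend.eventually hle] with t ht
    rw [hγ0, h1]
    exact pow_le_pow_left₀ (norm_nonneg _) ht 2
  have hk0 := hk.self_of_nhds
  have hγ0' := hev.self_of_nhds
  have hfirst := hmax.hasDerivAt_eq_zero hk0
  have hsecond := hmax.deriv_deriv_nonpos hk0.continuousAt
  have hde : deriv (fun t => ‖γ t‖ ^ 2) =ᶠ[𝓝 0]
      fun t => 2 * inner ℝ (γ t) (fderiv ℝ F (t • w) w) := hk.mono fun t ht => ht.deriv
  -- This is `(‖γ‖²)'' = 2 (⟪γ, γ''⟫ + ‖γ'‖²)` at 0.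
  have hdd := (((hγ0').inner ℝ (hF.hasDerivAt_fderiv_line w)).const_mul 2)
  rw [hde.deriv_eq, hdd.deriv] at hsecond
  simp only [zero_smul, hγ0, real_inner_self_eq_norm_sq] at hsecond hfirst
  exact ⟨by linarith, by linarith⟩

/-- The local form of a fold: `F (t w) = P (t u(w) + t² s(w) q)`, with `P` of invertible differential,
`u` of range a complement of `q`, and `s` nonzero off `0` on the kernel of `u`. -/
structure IsFoldForm (F : E → V) (P : V → V) (u : E → V) (s : E → ℝ) (q : V) : Prop where
  contDiffAt : ContDiffAt ℝ 2 F 0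
  contDiffAt_cod : ContDiffAt ℝ 2 P 0
  surjective : Function.Surjective (fderiv ℝ P 0)
  eq_zero : ∀ w, u w = 0 → s w = 0 → w = 0
  exists_add : ∀ y, ∃ w c, y = u w + (c : ℝ) • q
  apply_smul : ∀ w, ∀ᶠ t : ℝ in 𝓝 0, F (t • w) = P (t • u w + t ^ 2 • s w • q)

namespace IsFoldForm

variable {F : E → V} {P : V → V} {u : E → V} {s : E → ℝ} {q : V}

theorem eventually_hasDerivAt (h : IsFoldForm F P u s q) (w : E) : ∀ᶠ t : ℝ in 𝓝 0,
    HasDerivAt (fun t : ℝ => P (t • u w + t ^ 2 • s w • q))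
      (fderiv ℝ P (t • u w + t ^ 2 • s w • q) (u w + (2 * t) • s w • q)) t := by
  have hdiff : ∀ᶠ y in 𝓝 (0 : V), DifferentiableAt ℝ P y :=
    (h.contDiffAt_cod.eventually (by simp)).mono fun y hy => hy.differentiableAt (by norm_num)
  have htend : Filter.Tendsto (fun t : ℝ => t • u w + t ^ 2 • s w • q) (𝓝 0) (𝓝 0) := by
    have : Continuous fun t : ℝ => t • u w + t ^ 2 • s w • q := by fun_prop
    simpa using this.tendsto 0
  filter_upwards [htend.eventually hdiff] with t ht
  have h4 : HasDerivAt (fun t : ℝ => t • u w + t ^ 2 • s w • q) (u w + (2 * t) • s w • q) t := by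
    have h5 := ((hasDerivAt_id t).smul_const (u w)).add
      (((hasDerivAt_id t).pow 2).smul_const (s w • q))
    simp only [id_eq, one_smul, Nat.cast_ofNat, Nat.add_one_sub_one, pow_one, mul_one] at h5
    exact h5
  exact ht.hasFDerivAt.comp_hasDerivAt t h4

theorem fderiv_apply (h : IsFoldForm F P u s q) (w : E) : fderiv ℝ F 0 w = fderiv ℝ P 0 (u w) := by
  have h1 := (h.contDiffAt.eventually_hasDerivAt_line w).self_of_nhds
  have h2 := (h.eventually_hasDerivAt w).self_of_nhds
  have h3 := h2.congr_of_eventuallyEq (h.apply_smul w)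
  simpa using h1.unique h3

/-- On the zero set of `u` the curve is `P (t² s(w) q)`. Its velocity carries the factor `2 t`, so
at 0 no second derivative of `P` survives. -/
theorem fderiv_fderiv_apply (h : IsFoldForm F P u s q) {w : E} (hw : u w = 0) :
    fderiv ℝ (fderiv ℝ F) 0 w w = (2 * s w) • fderiv ℝ P 0 q := by
  have h1 := h.contDiffAt.hasDerivAt_fderiv_line w
  have heq : (fun t : ℝ => fderiv ℝ F (t • w) w) =ᶠ[𝓝 0]
      fun t => (2 * t) • fderiv ℝ P (t ^ 2 • s w • q) (s w • q) := by
    filter_upwards [h.contDiffAt.eventually_hasDerivAt_line w, h.eventually_hasDerivAt w,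
      (h.apply_smul w).eventually_nhds] with t h2 h3 h4
    have h5 := h2.unique (h3.congr_of_eventuallyEq h4)
    rw [h5, hw]
    simp
  have hd1 : ContDiffAt ℝ 1 (fderiv ℝ P) 0 := h.contDiffAt_cod.fderiv_right (by norm_num)
  have hd2 : HasFDerivAt (fderiv ℝ P) (fderiv ℝ (fderiv ℝ P) 0) ((0 : ℝ) ^ 2 • s w • q) := by
    rw [zero_pow two_ne_zero, zero_smul]
    exact (hd1.differentiableAt one_ne_zero).hasFDerivAt
  have h4 : DifferentiableAt ℝ (fun t : ℝ => t ^ 2 • s w • q) 0 := by fun_prop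
  have h5 : DifferentiableAt ℝ (fun t : ℝ => fderiv ℝ P (t ^ 2 • s w • q)) 0 :=
    (hd2.comp_hasDerivAt (0 : ℝ) h4.hasDerivAt).differentiableAt
  have h6 : HasDerivAt (fun t : ℝ => 2 * t) 2 0 := by
    simpa using (hasDerivAt_id (0 : ℝ)).const_mul 2
  have h7 := h6.smul (h5.clm_apply (differentiableAt_const (s w • q))).hasDerivAt
  rw [h1.unique (h7.congr_of_eventuallyEq heq)]
  simp [mul_smul]

/-- The range of the differential of `F` and the image of `q` under that of `P` together span `V`; a
vector orthogonal to both is orthogonal to itself. -/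
theorem inner_ne_zero (h : IsFoldForm F P u s q) {b : V} (hb : b ≠ 0) (hort : ∀ w, inner ℝ b (fderiv ℝ F 0 w) = 0) :
    inner ℝ b (fderiv ℝ P 0 q) ≠ 0 := fun h0 => by
  obtain ⟨y, hy⟩ := h.surjective b
  obtain ⟨w, c, rfl⟩ := h.exists_add y
  have h1 := hort w
  rw [h.fderiv_apply] at h1
  have h2 : inner ℝ b b = (0 : ℝ) := by
    nth_rw 2 [← hy]
    rw [map_add, map_smul, inner_add_right, inner_smul_right, h1, h0]
    simp
  exact hb (inner_self_eq_zero.1 h2)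

/-- The normal line of a fold is unique. -/
theorem eq_or_eq_neg (h : IsFoldForm F P u s q) {a b : V} (ha : ‖a‖ = 1) (hb : ‖b‖ = 1)
    (hort : ∀ w, inner ℝ a (fderiv ℝ F 0 w) = 0) (hort' : ∀ w, inner ℝ b (fderiv ℝ F 0 w) = 0) :
    a = b ∨ a = -b := by
  have hb0 : b ≠ 0 := fun h => by simp [h] at hb
  set α : ℝ := inner ℝ a (fderiv ℝ P 0 q)
  set β : ℝ := inner ℝ b (fderiv ℝ P 0 q)
  have hβ : β ≠ 0 := h.inner_ne_zero hb0 hort'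
  -- The difference is orthogonal to the range and, by the choice of `α` and `β`, also to the image
  -- of `q`; hence it vanishes.
  have hab : β • a = α • b := by
    by_contra hne
    refine h.inner_ne_zero (sub_ne_zero.2 hne) (fun w => ?_) ?_
    · rw [inner_sub_left, inner_smul_left, inner_smul_left, hort, hort']
      simp
    · rw [inner_sub_left, inner_smul_left, inner_smul_left]
      change β * α - α * β = 0
      ring
  have hnorm : |β| = |α| := by
    have := congrArg norm hab
    simpa [norm_smul, ha, hb] using this
  rcases abs_eq_abs.1 hnorm with h1 | h1
  · left
    rw [h1] at hab
    exact smul_right_injective V (h1 ▸ hβ) hab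
  · right
    refine smul_right_injective V hβ ?_
    change β • a = β • -b
    rw [hab, h1]
    simp

/-- At a fold on the unit sphere, the height in the normal direction decreases along rays. -/
theorem exists_radial [FiniteDimensional ℝ V] (h : IsFoldForm F P u s q)
    [FiniteDimensional ℝ E] (h1 : ‖F 0‖ = 1)
    (hle : ∀ᶠ y in 𝓝 (0 : E), ‖F y‖ ≤ 1) :
    ∃ r > 0, ∀ y, ‖y‖ < r → y ≠ 0 → ∀ t : ℝ, 0 < t → t < 1 →
      (inner ℝ (F 0) (F y) : ℝ) < inner ℝ (F 0) (F ((1 - t) • y)) := by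
  have hF0 : F 0 ≠ 0 := fun h => by simp [h] at h1
  have hdiff : ∀ᶠ y in 𝓝 (0 : E), DifferentiableAt ℝ F y :=
    (h.contDiffAt.eventually (by simp)).mono fun y hy => hy.differentiableAt (by norm_num)
  have hbound := inner_fderiv_of_norm_le_one h.contDiffAt h1 hle
  set L : V →L[ℝ] ℝ := innerSL ℝ (F 0)
  have hev : fderiv ℝ (fun y => L (F y)) =ᶠ[𝓝 0] fun y => L.comp (fderiv ℝ F y) :=
    hdiff.mono fun y hy => (L.hasFDerivAt.comp y hy.hasFDerivAt).fderiv
  have hd1 : ContDiffAt ℝ 1 (fderiv ℝ F) 0 := h.contDiffAt.fderiv_right (by norm_num)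
  have hdd := (hd1.differentiableAt one_ne_zero).hasFDerivAt
  have hsecond : fderiv ℝ (fderiv ℝ fun y => L (F y)) 0 =
      (ContinuousLinearMap.compL ℝ E V ℝ L).comp (fderiv ℝ (fderiv ℝ F) 0) := by
    rw [hev.fderiv_eq]
    exact ((ContinuousLinearMap.compL ℝ E V ℝ L).hasFDerivAt.comp (0 : E) hdd).fderiv
  refine exists_radial_of_fderiv_fderiv_neg (G := fun y => L (F y))
    (L.contDiff.contDiffAt.comp 0 h.contDiffAt) ?_ fun w hw => ?_
  · rw [hev.self_of_nhds]
    ext w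
    exact (hbound w).1
  · rw [hsecond]
    change inner ℝ (F 0) (fderiv ℝ (fderiv ℝ F) 0 w w) < (0 : ℝ)
    have h2 := (hbound w).2
    -- Off the kernel the term `‖fderiv ℝ F 0 w‖ ^ 2` makes the inequality strict. On the kernel
    -- only `≤ 0` is known, and the fold form rules out equality.
    by_cases h0 : fderiv ℝ F 0 w = 0
    · rw [h0, norm_zero] at h2
      refine lt_of_le_of_ne (by linarith) ?_
      have hq := h.inner_ne_zero hF0 fun w => (hbound w).1
      have hinj : Function.Injective (fderiv ℝ P 0) :=
        (LinearMap.injective_iff_surjective (f := (fderiv ℝ P 0 : V →ₗ[ℝ] V))).2 h.surjective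
      rw [h.fderiv_apply] at h0
      have hu : u w = 0 := hinj (by rw [h0, map_zero])
      rw [h.fderiv_fderiv_apply hu, inner_smul_right]
      have hs : s w ≠ 0 := fun hs => hw (h.eq_zero w hu hs)
      exact mul_ne_zero (mul_ne_zero two_ne_zero hs) hq
    · have : 0 < ‖fderiv ℝ F 0 w‖ ^ 2 := by positivity
      linarith

end IsFoldForm

end SecondDerivative

/-! ### Definite folds -/

section FoldModel

variable {n p : ℕ}

/-- The first `p - 1` coordinates, as a vector of `ℝᵖ` with last coordinate zero. -/
noncomputable def foldBase (p : ℕ) (w : EuclideanSpace ℝ (Fin n)) : EuclideanSpace ℝ (Fin p) :=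
  WithLp.toLp 2 fun j => if h : (j : ℕ) + 1 < p ∧ (j : ℕ) < n then w ⟨j, h.2⟩ else 0

/-- The sum of the squares of the coordinates from the `p`-th one on. -/
noncomputable def foldSq (p : ℕ) (w : EuclideanSpace ℝ (Fin n)) : ℝ :=
  ∑ i : Fin n, if (i : ℕ) + 1 < p then 0 else w i ^ 2

/-- The last vector of the standard basis. -/
noncomputable def foldDir (p : ℕ) [NeZero p] : EuclideanSpace ℝ (Fin p) :=
  EuclideanSpace.single ⟨p - 1, Nat.sub_one_lt (NeZero.ne p)⟩ 1

theorem foldBase_apply (w : EuclideanSpace ℝ (Fin n)) (j : Fin p) :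
    foldBase p w j = if h : (j : ℕ) + 1 < p ∧ (j : ℕ) < n then w ⟨j, h.2⟩ else 0 := rfl

theorem foldBase_smul (t : ℝ) (w : EuclideanSpace ℝ (Fin n)) :
    foldBase p (t • w) = t • foldBase p w := by
  ext j
  rw [PiLp.smul_apply, foldBase_apply, foldBase_apply]
  split_ifs <;> simp

theorem foldSq_smul (t : ℝ) (w : EuclideanSpace ℝ (Fin n)) :
    foldSq p (t • w) = t ^ 2 * foldSq p w := by
  simp only [foldSq, Finset.mul_sum]
  refine Finset.sum_congr rfl fun i _ => ?_
  split_ifs <;> simp [mul_pow]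

theorem foldSq_nonneg (w : EuclideanSpace ℝ (Fin n)) : 0 ≤ foldSq p w :=
  Finset.sum_nonneg fun i _ => by split_ifs <;> positivity

theorem eq_zero_of_foldBase_of_foldSq {w : EuclideanSpace ℝ (Fin n)} (h : foldBase p w = 0)
    (h' : foldSq p w = 0) : w = 0 := by
  ext i
  by_cases hi : (i : ℕ) + 1 < p
  · have := congrArg (fun v : EuclideanSpace ℝ (Fin p) => v ⟨i, by omega⟩) h
    simpa [foldBase_apply, hi] using this
  · have := (Finset.sum_eq_zero_iff_of_nonneg fun i _ => by split_ifs <;> positivity).1 h' i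
      (Finset.mem_univ i)
    simpa [hi] using this

variable [NeZero p]

theorem foldDir_apply (j : Fin p) : foldDir p j = if (j : ℕ) + 1 = p then 1 else 0 := by
  have hp := NeZero.ne p
  rw [foldDir, PiLp.single_apply]
  congr 1
  rw [eq_iff_iff, Fin.ext_iff]
  change (j : ℕ) = p - 1 ↔ _
  omega

theorem foldBase_add_smul_foldDir_apply (w : EuclideanSpace ℝ (Fin n)) (c : ℝ) (j : Fin p) :
    (foldBase p w + c • foldDir p) j = if (j : ℕ) + 1 = p then c else foldBase p w j := by
  rw [PiLp.add_apply, PiLp.smul_apply, foldDir_apply]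
  split_ifs with h
  · rw [foldBase_apply, dif_neg (by omega)]
    simp
  · simp

theorem foldBase_add_inj {w w' : EuclideanSpace ℝ (Fin n)} {c c' : ℝ}
    (h : foldBase p w + c • foldDir p = foldBase p w' + c' • foldDir p) :
    foldBase p w = foldBase p w' ∧ c = c' := by
  have hp := NeZero.ne p
  have hj : ∀ j : Fin p, (if (j : ℕ) + 1 = p then c else foldBase p w j) =
      if (j : ℕ) + 1 = p then c' else foldBase p w' j := fun j => by
    rw [← foldBase_add_smul_foldDir_apply, ← foldBase_add_smul_foldDir_apply, h]
  have hc : c = c' := by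
    have := hj ⟨p - 1, by omega⟩
    rwa [if_pos (by simp; omega), if_pos (by simp; omega)] at this
  subst hc
  exact ⟨add_right_cancel h, rfl⟩

theorem exists_eq_foldBase_add (hpn : p ≤ n) (y : EuclideanSpace ℝ (Fin p)) :
    ∃ (w : EuclideanSpace ℝ (Fin n)) (c : ℝ), y = foldBase p w + c • foldDir p := by
  have hp := NeZero.ne p
  -- Padding `y` by zeros suffices: `foldBase` ignores the last coordinate of `y`, which is supplied
  -- by `c`.
  refine ⟨WithLp.toLp 2 fun i => if h : (i : ℕ) < p then y ⟨i, h⟩ else 0, y ⟨p - 1, by omega⟩, ?_⟩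
  ext j
  rw [foldBase_add_smul_foldDir_apply]
  split_ifs with h
  · rw [show j = ⟨p - 1, by omega⟩ from Fin.ext (by simp; omega)]
  · rw [foldBase_apply, dif_pos (by omega)]
    simp

end FoldModel

/-! ### Derivatives of smooth maps in charts. -/

section Chart

variable {n p : ℕ} {M : Type*} [TopologicalSpace M] [ChartedSpace (EuclideanSpace ℝ (Fin n)) M]

theorem contDiffAt_comp_symm {f : M → EuclideanSpace ℝ (Fin p)}
    (hf : ContMDiff (𝓡 n) (𝓡 p) ∞ f) {φ : OpenPartialHomeomorph M (EuclideanSpace ℝ (Fin n))}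
    (hφ : φ ∈ IsManifold.maximalAtlas (𝓡 n) ∞ M) {y : EuclideanSpace ℝ (Fin n)}
    (hy : y ∈ φ.target) : ContDiffAt ℝ ∞ (f ∘ φ.symm) y :=
  ((hf (φ.symm y)).comp y (contMDiffAt_symm_of_mem_maximalAtlas hφ hy)).contDiffAt

theorem surjective_fderiv_chart {f : M → EuclideanSpace ℝ (Fin p)}
    (hf : ContMDiff (𝓡 n) (𝓡 p) ∞ f) {x : M} (hx : x ∉ singularLocus n f) :
    Function.Surjective (fderiv ℝ (f ∘ (chartAt (EuclideanSpace ℝ (Fin n)) x).symm)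
      (chartAt (EuclideanSpace ℝ (Fin n)) x x)) := by
  have h1 : Function.Surjective (mfderiv (𝓡 n) (𝓡 p) f x) := not_not.1 hx
  have hd : MDifferentiableAt (𝓡 n) (𝓡 p) f x := (hf x).mdifferentiableAt (by simp)
  rw [hd.mfderiv, (𝓡 n).range_eq_univ, fderivWithin_univ] at h1
  exact h1

end Chart

/-! ### Normal form charts at definite folds. -/

section FoldChart

variable {n p : ℕ} [NeZero p] {M : Type*} [TopologicalSpace M]
  [ChartedSpace (EuclideanSpace ℝ (Fin n)) M]

/-- The charts `φ` and `ψ` bring `f` into the normal form of a definite fold at `x`. -/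
structure IsDefiniteFoldChart (f : M → EuclideanSpace ℝ (Fin p)) (x : M)
    (φ : OpenPartialHomeomorph M (EuclideanSpace ℝ (Fin n)))
    (ψ : OpenPartialHomeomorph (EuclideanSpace ℝ (Fin p)) (EuclideanSpace ℝ (Fin p)))
    (σ : ℝ) : Prop where
  mem_maximalAtlas : φ ∈ IsManifold.maximalAtlas (𝓡 n) ∞ M
  mem_maximalAtlas_cod : ψ ∈ IsManifold.maximalAtlas (𝓡 p) ∞ (EuclideanSpace ℝ (Fin p))
  sign : σ = 1 ∨ σ = -1
  mem_source : x ∈ φ.source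
  apply_eq_zero : φ x = 0
  apply_map_eq_zero : ψ (f x) = 0
  source_subset : φ.source ⊆ f ⁻¹' ψ.source
  apply_map : ∀ z ∈ φ.source,
    ψ (f z) = foldBase p (φ z) + (σ * foldSq p (φ z)) • foldDir p

theorem IsDefiniteFoldPoint.exists_chart {f : M → EuclideanSpace ℝ (Fin p)} {x : M} (hpn : p ≤ n)
    (h : IsDefiniteFoldPoint n f x) : ∃ (φ : OpenPartialHomeomorph M (EuclideanSpace ℝ (Fin n)))
      (ψ : OpenPartialHomeomorph (EuclideanSpace ℝ (Fin p)) (EuclideanSpace ℝ (Fin p))) (σ : ℝ),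
      IsDefiniteFoldChart f x φ ψ σ := by
  obtain ⟨l, hl, hmax, φ, hφ, ψ, hψ, h1, h2, h3, h4, h5⟩ := h
  have hp := NeZero.ne p
  have key : ∀ σ : ℝ, (σ = 1 ∨ σ = -1) → (∀ i : Fin n, ∀ a : ℝ, (if (i : ℕ) + 1 < p then 0
      else if (i : ℕ) + 1 < p + l then a ^ 2 else -a ^ 2) =
      σ * if (i : ℕ) + 1 < p then 0 else a ^ 2) → IsDefiniteFoldChart f x φ ψ σ := by
    refine fun σ hσ hsum => ⟨hφ, hψ, hσ, h1, h2, h3, h4, fun z hz => ?_⟩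
    ext j
    rw [foldBase_add_smul_foldDir_apply]
    split_ifs with hj
    · rw [(h5 z hz).2 j hj, foldSq, Finset.mul_sum]
      exact Finset.sum_congr rfl fun i _ => hsum i _
    · have hj' : (j : ℕ) + 1 < p := by omega
      rw [(h5 z hz).1 ⟨j, by omega⟩ j rfl hj', foldBase_apply, dif_pos ⟨hj', by omega⟩]
  -- The absolute index is maximal only if all squares have the same sign, which becomes `σ`.
  have hl' : l = n + 1 - p ∨ l = 0 := by omega
  rcases hl' with rfl | rfl
  · refine ⟨φ, ψ, 1, key 1 (Or.inl rfl) fun i a => ?_⟩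
    rw [if_pos (show (i : ℕ) + 1 < p + (n + 1 - p) by omega), one_mul]
  · refine ⟨φ, ψ, -1, key (-1) (Or.inr rfl) fun i a => ?_⟩
    by_cases hi : (i : ℕ) + 1 < p <;> simp [hi]

namespace IsDefiniteFoldChart

variable {f : M → EuclideanSpace ℝ (Fin p)} {x : M}
  {φ : OpenPartialHomeomorph M (EuclideanSpace ℝ (Fin n))}
  {ψ : OpenPartialHomeomorph (EuclideanSpace ℝ (Fin p)) (EuclideanSpace ℝ (Fin p))} {σ : ℝ}

theorem zero_mem_target (h : IsDefiniteFoldChart f x φ ψ σ) : 0 ∈ φ.target := by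
  rw [← h.apply_eq_zero]; exact φ.map_source h.mem_source

theorem zero_mem_target_cod (h : IsDefiniteFoldChart f x φ ψ σ) : 0 ∈ ψ.target := by
  rw [← h.apply_map_eq_zero]; exact ψ.map_source (h.source_subset h.mem_source)

theorem symm_zero (h : IsDefiniteFoldChart f x φ ψ σ) : φ.symm 0 = x := by
  rw [← h.apply_eq_zero, φ.left_inv h.mem_source]

theorem symm_zero_cod (h : IsDefiniteFoldChart f x φ ψ σ) : ψ.symm 0 = f x := by
  rw [← h.apply_map_eq_zero, ψ.left_inv (h.source_subset h.mem_source)]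

theorem sign_ne_zero (h : IsDefiniteFoldChart f x φ ψ σ) : σ ≠ 0 := by
  rcases h.sign with rfl | rfl <;> norm_num

theorem eq_of_map_eq (h : IsDefiniteFoldChart f x φ ψ σ) {z z' : M} (hz : z ∈ φ.source)
    (hz' : z' ∈ φ.source) (hzz : f z = f z') :
    foldBase p (φ z) = foldBase p (φ z') ∧ foldSq p (φ z) = foldSq p (φ z') := by
  have h1 := h.apply_map z hz
  rw [hzz, h.apply_map z' hz'] at h1
  obtain ⟨h2, h3⟩ := foldBase_add_inj h1
  exact ⟨h2.symm, (mul_left_cancel₀ h.sign_ne_zero h3).symm⟩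

/-- Definiteness is used here: a vanishing sum of squares forces all its terms to vanish, so a fold
point is isolated in its fibre. -/
theorem eq_of_map_eq_self (h : IsDefiniteFoldChart f x φ ψ σ) {z : M} (hz : z ∈ φ.source)
    (hzx : f z = f x) : z = x := by
  obtain ⟨h1, h2⟩ := h.eq_of_map_eq hz h.mem_source hzx
  have h3 : foldBase p (0 : EuclideanSpace ℝ (Fin n)) = 0 := by
    simpa using foldBase_smul (p := p) 0 (0 : EuclideanSpace ℝ (Fin n))
  have h4 : foldSq p (0 : EuclideanSpace ℝ (Fin n)) = 0 := by
    simpa using foldSq_smul (p := p) 0 (0 : EuclideanSpace ℝ (Fin n))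
  rw [h.apply_eq_zero] at h1 h2
  refine φ.injOn hz h.mem_source ?_
  rw [h.apply_eq_zero]
  exact eq_zero_of_foldBase_of_foldSq (h1.trans h3) (h2.trans h4)

theorem isFoldForm (h : IsDefiniteFoldChart f x φ ψ σ) (hpn : p ≤ n)
    (hf : ContMDiff (𝓡 n) (𝓡 p) ∞ f) :
    IsFoldForm (f ∘ φ.symm) ψ.symm (foldBase p) (fun w => σ * foldSq p w) (foldDir p) where
  contDiffAt := contDiffAt_infty.1
    (contDiffAt_comp_symm hf h.mem_maximalAtlas h.zero_mem_target) 2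
  contDiffAt_cod := contDiffAt_infty.1 (contMDiffAt_symm_of_mem_maximalAtlas
    h.mem_maximalAtlas_cod h.zero_mem_target_cod).contDiffAt 2
  surjective := by
    have h1 : DifferentiableAt ℝ ψ.symm 0 := (contMDiffAt_symm_of_mem_maximalAtlas
      h.mem_maximalAtlas_cod h.zero_mem_target_cod).contDiffAt.differentiableAt (by simp)
    have h2 : DifferentiableAt ℝ ψ (ψ.symm 0) := (contMDiffAt_of_mem_maximalAtlas
      h.mem_maximalAtlas_cod (ψ.map_target h.zero_mem_target_cod)).contDiffAt.differentiableAt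
        (by simp)
    have h3 : (fun y => ψ.symm (ψ y)) =ᶠ[𝓝 (ψ.symm 0)] id :=
      ψ.eventually_left_inverse (ψ.map_target h.zero_mem_target_cod)
    have h4 : ψ (ψ.symm 0) = 0 := ψ.right_inv h.zero_mem_target_cod
    rw [← h4] at h1
    have h5 := (h1.hasFDerivAt.comp _ h2.hasFDerivAt).unique
      ((hasFDerivAt_id (𝕜 := ℝ) (ψ.symm 0)).congr_of_eventuallyEq h3)
    rw [h4] at h5
    exact fun y => ⟨fderiv ℝ ψ (ψ.symm 0) y, DFunLike.congr_fun h5 y⟩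
  eq_zero w hw hs := eq_zero_of_foldBase_of_foldSq hw
    ((mul_eq_zero.1 hs).resolve_left h.sign_ne_zero)
  exists_add := exists_eq_foldBase_add hpn
  apply_smul w := by
    have htend : Filter.Tendsto (fun t : ℝ => t • w) (𝓝 0) (𝓝 0) := by
      have : Continuous fun t : ℝ => t • w := by fun_prop
      simpa using this.tendsto 0
    filter_upwards [htend.eventually (φ.open_target.mem_nhds h.zero_mem_target)] with t ht
    have hs := φ.map_target ht
    have h1 := h.apply_map _ hs
    rw [φ.right_inv ht, foldBase_smul, foldSq_smul] at h1
    rw [Function.comp_apply, ← ψ.left_inv (h.source_subset hs), h1, smul_smul]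
    congr 3
    ring

end IsDefiniteFoldChart

end FoldChart

/-! ### Special generic maps onto the closed ball with connected fibres -/

section Fibres

/-- If the fibres of `f` are connected, then an isolated point of a fibre is the whole fibre. -/
theorem eq_of_isolated_of_injective_steinMap {X Y : Type*} [TopologicalSpace X] [T1Space X]
    {f : X → Y} (hinj : Function.Injective (steinMap f)) {x : X} {U : Set X} (hU : IsOpen U)
    (hx : x ∈ U) (hiso : ∀ z ∈ U, f z = f x → z = x) {z : X} (hz : f z = f x) : z = x := by
  -- Injectivity puts the whole fibre into one connected component; an isolated point `x` would
  -- split off any further point `z`.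
  have h1 : steinProj f x = steinProj f z := hinj hz.symm
  have h2 : z ∈ connectedComponentIn (f ⁻¹' {f x}) x :=
    (Quotient.exact (s := steinSetoid f) h1).2
  by_contra hne
  obtain ⟨w, hwC, hwU, hw⟩ := isPreconnected_connectedComponentIn (F := f ⁻¹' {f x}) (x := x)
    U {x}ᶜ hU isOpen_compl_singleton (fun w _ => by
      by_cases hw : w = x
      · exact Or.inl (hw ▸ hx)
      · exact Or.inr hw)
    ⟨x, mem_connectedComponentIn rfl, hx⟩ ⟨z, h2, hne⟩
  exact hw (hiso w hwU (connectedComponentIn_subset (f ⁻¹' {f x}) x hwC))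

end Fibres

section Ball

variable {n p : ℕ} {M : Type*} [TopologicalSpace M]
  [ChartedSpace (EuclideanSpace ℝ (Fin n)) M] {f : M → EuclideanSpace ℝ (Fin p)}

theorem range_mem_nhds_of_notMem_singularLocus (hf : ContMDiff (𝓡 n) (𝓡 p) ∞ f)
    [IsManifold (𝓡 n) ∞ M] {x : M} (hx : x ∉ singularLocus n f) : Set.range f ∈ 𝓝 (f x) := by
  set φ := chartAt (EuclideanSpace ℝ (Fin n)) x
  have hxs : x ∈ φ.source := mem_chart_source _ x
  have h1 := (contDiffAt_comp_symm hf (IsManifold.chart_mem_maximalAtlas x)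
    (φ.map_source hxs)).hasStrictFDerivAt (by simp)
  have h2 := h1.map_nhds_eq_of_surj (LinearMap.range_eq_top.2 (surjective_fderiv_chart hf hx))
  rw [Function.comp_apply, φ.left_inv hxs] at h2
  rw [← h2]
  exact Filter.mem_map.2 (Filter.univ_mem' fun y => ⟨_, rfl⟩)

/-- At a regular point the image would contain a neighbourhood of a boundary point of the ball. -/
theorem mem_singularLocus_of_norm_eq_one (hf : ContMDiff (𝓡 n) (𝓡 p) ∞ f)
    [IsManifold (𝓡 n) ∞ M] (himage : Set.range f = Metric.closedBall 0 1) {x : M}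
    (hx : ‖f x‖ = 1) : x ∈ singularLocus n f := by
  by_contra h
  have h1 := range_mem_nhds_of_notMem_singularLocus hf h
  rw [himage] at h1
  have h2 : f x ∈ interior (Metric.closedBall (0 : EuclideanSpace ℝ (Fin p)) 1) :=
    mem_interior_iff_mem_nhds.2 h1
  rw [interior_closedBall _ one_ne_zero, mem_ball_zero_iff] at h2
  linarith

variable [NeZero p]

/-- If `f x` were interior, all nearby values would be attained. They cannot be attained outside the
chart, whose complement has a compact image missing `f x`, and inside the chart only one side of the
fold is reached. -/
theorem IsDefiniteFoldChart.norm_eq_one [CompactSpace M] [T2Space M] (hf : Continuous f)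
    (himage : Set.range f = Metric.closedBall 0 1) (hinj : Function.Injective (steinMap f)) {x : M}
    {φ : OpenPartialHomeomorph M (EuclideanSpace ℝ (Fin n))}
    {ψ : OpenPartialHomeomorph (EuclideanSpace ℝ (Fin p)) (EuclideanSpace ℝ (Fin p))} {σ : ℝ}
    (h : IsDefiniteFoldChart f x φ ψ σ) : ‖f x‖ = 1 := by
  have hle : ‖f x‖ ≤ 1 := by
    rw [← mem_closedBall_zero_iff, ← himage]
    exact ⟨x, rfl⟩
  refine le_antisymm hle (not_lt.1 fun hlt => ?_)
  have hcl : IsClosed (f '' φ.sourceᶜ) :=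
    (φ.open_source.isClosed_compl.isCompact.image hf).isClosed
  have hnot : f x ∉ f '' φ.sourceᶜ := by
    rintro ⟨z, hz, hzx⟩
    have := eq_of_isolated_of_injective_steinMap hinj φ.open_source h.mem_source
      (fun z hz hzx => h.eq_of_map_eq_self hz hzx) hzx
    exact hz (this ▸ h.mem_source)
  -- For `t > 0` these points lie on the side opposite to `σ * foldSq`, out of reach from the chart.
  have htend : Filter.Tendsto (fun t : ℝ => (-(σ * t)) • foldDir p) (𝓝 0) (𝓝 0) := by
    have : Continuous fun t : ℝ => (-(σ * t)) • foldDir p := by fun_prop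
    simpa using this.tendsto 0
  have htend' : Filter.Tendsto (fun t : ℝ => ψ.symm ((-(σ * t)) • foldDir p)) (𝓝 0) (𝓝 (f x)) := by
    rw [← h.symm_zero_cod]
    exact (ψ.continuousAt_symm h.zero_mem_target_cod).tendsto.comp htend
  have hev := ((htend.eventually (ψ.open_target.mem_nhds h.zero_mem_target_cod)).and
    (htend'.eventually (hcl.isOpen_compl.mem_nhds hnot))).and
    (htend'.eventually (Metric.isOpen_ball.mem_nhds (mem_ball_zero_iff.2 hlt)))
  obtain ⟨t, ⟨⟨h1, h2⟩, h3⟩, ht⟩ := ((hev.filter_mono nhdsWithin_le_nhds).and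
    (self_mem_nhdsWithin : ∀ᶠ t : ℝ in 𝓝[>] 0, t ∈ Set.Ioi 0)).exists
  have h4 : ψ.symm ((-(σ * t)) • foldDir p) ∈ Set.range f := by
    rw [himage]
    exact Metric.ball_subset_closedBall h3
  obtain ⟨z, hz⟩ := h4
  have hzs : z ∈ φ.source := by
    by_contra hzs
    exact h2 ⟨z, hzs, hz⟩
  have h5 := h.apply_map z hzs
  rw [hz, ψ.right_inv h1] at h5
  have h6 : foldBase p (0 : EuclideanSpace ℝ (Fin n)) = 0 := by
    simpa using foldBase_smul (p := p) 0 (0 : EuclideanSpace ℝ (Fin n))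
  rw [← zero_add (_ • foldDir p), ← h6] at h5
  have h7 := (foldBase_add_inj h5).2
  have h8 : -t = foldSq p (φ z) := mul_left_cancel₀ h.sign_ne_zero (by rw [← h7]; ring)
  have h9 := foldSq_nonneg (p := p) (φ z)
  have h10 : 0 < t := ht
  linarith

/-- In equal dimensions a fold has nearby fibres with two points. -/
theorem IsDefiniteFoldChart.ne_of_injective_steinMap [T1Space M] {f : M → EuclideanSpace ℝ (Fin p)}
    (hinj : Function.Injective (steinMap f)) {x : M}
    {φ : OpenPartialHomeomorph M (EuclideanSpace ℝ (Fin n))}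
    {ψ : OpenPartialHomeomorph (EuclideanSpace ℝ (Fin p)) (EuclideanSpace ℝ (Fin p))} {σ : ℝ}
    (h : IsDefiniteFoldChart f x φ ψ σ) : p ≠ n := by
  rintro rfl
  have htend : Filter.Tendsto (fun t : ℝ => t • foldDir p) (𝓝 0) (𝓝 0) := by
    have : Continuous fun t : ℝ => t • foldDir p := by fun_prop
    simpa using this.tendsto 0
  have htend' : Filter.Tendsto (fun t : ℝ => (-t) • foldDir p) (𝓝 0) (𝓝 0) := by
    have : Continuous fun t : ℝ => (-t) • foldDir p := by fun_prop
    simpa using this.tendsto 0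
  have hev := (htend.eventually (φ.open_target.mem_nhds h.zero_mem_target)).and
    (htend'.eventually (φ.open_target.mem_nhds h.zero_mem_target))
  obtain ⟨t, ⟨h1, h2⟩, ht⟩ := ((hev.filter_mono nhdsWithin_le_nhds).and
    (self_mem_nhdsWithin : ∀ᶠ t : ℝ in 𝓝[>] 0, t ∈ Set.Ioi 0)).exists
  have ht0 : t ≠ 0 := (Set.mem_Ioi.1 ht).ne'
  have hbase : ∀ t : ℝ, foldBase p (t • foldDir p) = 0 := fun t => by
    ext j
    rw [foldBase_apply]
    split_ifs with hj
    · rw [PiLp.smul_apply, foldDir_apply, if_neg (by simp; omega)]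
      simp
    · simp
  have hsq : ∀ w : EuclideanSpace ℝ (Fin p), foldBase p w = 0 →
      ∃ a : ℝ, w = a • foldDir p := fun w hw => by
    have hp := NeZero.ne p
    refine ⟨w ⟨p - 1, by omega⟩, ?_⟩
    ext j
    rw [PiLp.smul_apply, foldDir_apply]
    split_ifs with hj
    · rw [show j = ⟨p - 1, by omega⟩ from Fin.ext (by simp; omega)]
      simp
    · have := congrArg (fun v : EuclideanSpace ℝ (Fin p) => v j) hw
      rw [foldBase_apply, dif_pos ⟨by omega, j.2⟩] at this
      simpa using this
  have hne : foldSq p (foldDir p) ≠ 0 := fun h0 => by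
    have h3 := hbase 1
    rw [one_smul] at h3
    have h4 := congrArg (fun v : EuclideanSpace ℝ (Fin p) =>
      v ⟨p - 1, Nat.sub_one_lt (NeZero.ne p)⟩) (eq_zero_of_foldBase_of_foldSq h3 h0)
    have hp := NeZero.ne p
    simp only [foldDir_apply] at h4
    rw [if_pos (by omega)] at h4
    simp at h4
  have hs1 := φ.map_target h1
  have hs2 := φ.map_target h2
  have hmap : f (φ.symm ((-t) • foldDir p)) = f (φ.symm (t • foldDir p)) := by
    refine ψ.injOn (h.source_subset hs2) (h.source_subset hs1) ?_
    rw [h.apply_map _ hs1, h.apply_map _ hs2, φ.right_inv h1, φ.right_inv h2, hbase, hbase,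
      foldSq_smul, foldSq_smul, neg_sq]
  have hdist : φ.symm ((-t) • foldDir p) ≠ φ.symm (t • foldDir p) := fun heq => by
    have h3 := φ.symm.injOn h2 h1 heq
    have h4 : foldDir p ≠ 0 := fun h0 => hne (by
      rw [h0]; simpa using foldSq_smul (p := p) 0 (0 : EuclideanSpace ℝ (Fin p)))
    have h5 := smul_left_injective ℝ h4 h3
    exact ht0 (by linarith)
  -- For `p = n` the vectors with `foldBase` zero form a line, so this fibre meets the chart only in
  -- the points with parameters `t` and `-t`. Removing one isolates the other, which must then be
  -- the whole fibre.
  refine hdist (eq_of_isolated_of_injective_steinMap hinj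
    (U := φ.source ∩ {φ.symm ((-t) • foldDir p)}ᶜ)
    (φ.open_source.inter isOpen_compl_singleton) ⟨hs1, hdist.symm⟩ ?_ hmap)
  rintro z ⟨hz, hz'⟩ hfz
  obtain ⟨h3, h4⟩ := h.eq_of_map_eq hz hs1 hfz
  rw [φ.right_inv h1, hbase] at h3
  obtain ⟨a, ha⟩ := hsq _ h3
  rw [φ.right_inv h1, ha, foldSq_smul, foldSq_smul] at h4
  have h5 : a ^ 2 = t ^ 2 := mul_right_cancel₀ hne h4
  rcases sq_eq_sq_iff_eq_or_eq_neg.1 h5 with rfl | rfl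
  · rw [← ha, φ.left_inv hz]
  · exact absurd (by rw [← ha, φ.left_inv hz]; rfl) hz'

theorem exists_map_eq_pole {M : Type*} {f : M → EuclideanSpace ℝ (Fin p)}
    (himage : Set.range f = Metric.closedBall 0 1) (a : ℝ) (ha : |a| = 1) :
    ∃ x, f x = a • ClosedDisk.pole p := by
  have : a • ClosedDisk.pole p ∈ Set.range f := by
    rw [himage, mem_closedBall_zero_iff, norm_smul, Real.norm_eq_abs, ha]
    simp [ClosedDisk.pole]
  exact this

variable [IsManifold (𝓡 n) ∞ M]

namespace IsSpecialGeneric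

theorem exists_chart_of_norm_eq_one (hf : IsSpecialGeneric n f)
    (himage : Set.range f = Metric.closedBall 0 1) {x : M} (hx : ‖f x‖ = 1) :
    ∃ (φ : OpenPartialHomeomorph M (EuclideanSpace ℝ (Fin n)))
      (ψ : OpenPartialHomeomorph (EuclideanSpace ℝ (Fin p)) (EuclideanSpace ℝ (Fin p))) (σ : ℝ),
      IsDefiniteFoldChart f x φ ψ σ :=
  (hf.2.2.2 x (mem_singularLocus_of_norm_eq_one hf.2.2.1 himage hx)).exists_chart hf.2.1

theorem exists_radial_chart (hf : IsSpecialGeneric n f)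
    (himage : Set.range f = Metric.closedBall 0 1) {x : M} (hx : ‖f x‖ = 1) :
    ∃ φ : OpenPartialHomeomorph M (EuclideanSpace ℝ (Fin n)), x ∈ φ.source ∧ φ x = 0 ∧
      ∃ r > 0, ∀ y, ‖y‖ < r → y ≠ 0 → ∀ t : ℝ, 0 < t → t < 1 →
        (inner ℝ (f x) (f (φ.symm y)) : ℝ) < inner ℝ (f x) (f (φ.symm ((1 - t) • y))) := by
  obtain ⟨φ, ψ, σ, h⟩ := hf.exists_chart_of_norm_eq_one himage hx
  refine ⟨φ, h.mem_source, h.apply_eq_zero, ?_⟩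
  have hF := h.isFoldForm hf.2.1 hf.2.2.1
  have hFx : (f ∘ φ.symm) 0 = f x := by rw [Function.comp_apply, h.symm_zero]
  have := hF.exists_radial (by rwa [hFx]) (Filter.Eventually.of_forall fun y => by
    rw [← mem_closedBall_zero_iff, ← himage]; exact ⟨_, rfl⟩)
  rwa [hFx] at this

variable [T2Space M]

theorem singularLocus_eq [CompactSpace M] (hf : IsSpecialGeneric n f) (himage : Set.range f = Metric.closedBall 0 1)
    (hinj : Function.Injective (steinMap f)) : singularLocus n f = {x | ‖f x‖ = 1} := by
  ext x
  refine ⟨fun hx => ?_, fun hx => mem_singularLocus_of_norm_eq_one hf.2.2.1 himage hx⟩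
  obtain ⟨φ, ψ, σ, h⟩ := (hf.2.2.2 x hx).exists_chart hf.2.1
  exact h.norm_eq_one hf.2.2.1.continuous himage hinj

theorem eq_of_norm_eq_one (hf : IsSpecialGeneric n f) (himage : Set.range f = Metric.closedBall 0 1)
    (hinj : Function.Injective (steinMap f)) {x z : M} (hx : ‖f x‖ = 1) (hz : f z = f x) :
    z = x := by
  obtain ⟨φ, ψ, σ, h⟩ := hf.exists_chart_of_norm_eq_one himage hx
  exact eq_of_isolated_of_injective_steinMap hinj φ.open_source h.mem_source
    (fun z hz hzx => h.eq_of_map_eq_self hz hzx) hz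

theorem dim_lt (hf : IsSpecialGeneric n f) (himage : Set.range f = Metric.closedBall 0 1)
    (hinj : Function.Injective (steinMap f)) : p < n := by
  obtain ⟨x, hx⟩ := exists_map_eq_pole himage 1 (by simp)
  obtain ⟨φ, ψ, σ, h⟩ := hf.exists_chart_of_norm_eq_one himage (x := x)
    (by rw [hx]; simp [ClosedDisk.pole])
  exact lt_of_le_of_ne hf.2.1 (h.ne_of_injective_steinMap hinj)

/-- At a critical point of the height function `⟪b, f⟫` the map takes the value `b` or `-b`. -/
theorem exists_hasStrictFDerivAt_ne_zero [CompactSpace M] (hf : IsSpecialGeneric n f)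
    (himage : Set.range f = Metric.closedBall 0 1) (hinj : Function.Injective (steinMap f))
    {b : EuclideanSpace ℝ (Fin p)} (hb : ‖b‖ = 1) {x : M} (h1 : f x ≠ b) (h2 : f x ≠ -b) :
    ∃ φ : OpenPartialHomeomorph M (EuclideanSpace ℝ (Fin n)), x ∈ φ.source ∧
      ∃ G' : EuclideanSpace ℝ (Fin n) →L[ℝ] ℝ,
        HasStrictFDerivAt ((fun x => inner ℝ b (f x)) ∘ φ.symm) G' (φ x) ∧ G' ≠ 0 := by
  have key : ∀ φ ∈ IsManifold.maximalAtlas (𝓡 n) ∞ M, x ∈ φ.source →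
      HasStrictFDerivAt ((fun x => inner ℝ b (f x)) ∘ φ.symm)
        ((innerSL ℝ b).comp (fderiv ℝ (f ∘ φ.symm) (φ x))) (φ x) := fun φ hφ hx =>
    (innerSL ℝ b).hasStrictFDerivAt.comp _
      ((contDiffAt_comp_symm hf.2.2.1 hφ (φ.map_source hx)).hasStrictFDerivAt (by simp))
  have hb0 : b ≠ 0 := fun h => by simp [h] at hb
  by_cases hx : x ∈ singularLocus n f
  · have hx1 : ‖f x‖ = 1 := by
      have := hf.singularLocus_eq himage hinj
      rw [this] at hx
      exact hx
    obtain ⟨φ, ψ, σ, h⟩ := hf.exists_chart_of_norm_eq_one himage hx1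
    refine ⟨φ, h.mem_source, _, key φ h.mem_maximalAtlas h.mem_source, fun h0 => ?_⟩
    have hF := h.isFoldForm hf.2.1 hf.2.2.1
    have hFx : (f ∘ φ.symm) 0 = f x := by rw [Function.comp_apply, h.symm_zero]
    have hort := inner_fderiv_of_norm_le_one hF.contDiffAt (by rwa [hFx])
      (Filter.Eventually.of_forall fun y => by
        rw [← mem_closedBall_zero_iff, ← himage]; exact ⟨_, rfl⟩)
    rw [h.apply_eq_zero] at h0
    rw [hFx] at hort
    -- Both `f x` (by maximality of the norm) and `b` (by criticality of the height) are normal to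
    -- the image of the differential.
    rcases hF.eq_or_eq_neg hx1 hb (fun w => (hort w).1) (fun w => DFunLike.congr_fun h0 w)
      with h3 | h3
    · exact h1 h3
    · exact h2 h3
  · refine ⟨_, mem_chart_source _ x, _, key _ (IsManifold.chart_mem_maximalAtlas x)
      (mem_chart_source _ x), fun h0 => ?_⟩
    obtain ⟨w, hw⟩ := surjective_fderiv_chart hf.2.2.1 hx b
    have h3 : inner ℝ b (fderiv ℝ (f ∘ (chartAt (EuclideanSpace ℝ (Fin n)) x).symm)
      (chartAt (EuclideanSpace ℝ (Fin n)) x x) w) = (0 : ℝ) := DFunLike.congr_fun h0 w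
    rw [hw] at h3
    exact hb0 (inner_self_eq_zero.1 h3)

/-- The source of a special generic map onto the ball with connected fibres is a topological
sphere. -/
theorem nonempty_homeomorph_sphere [CompactSpace M] (hf : IsSpecialGeneric n f)
    (himage : Set.range f = Metric.closedBall 0 1) (hinj : Function.Injective (steinMap f)) :
    Nonempty (M ≃ₜ Metric.sphere (0 : EuclideanSpace ℝ (Fin (n + 1))) 1) := by
  set b := ClosedDisk.pole p
  have hb : ‖b‖ = 1 := by simp [b, ClosedDisk.pole]
  obtain ⟨xmax, hxmax⟩ := exists_map_eq_pole himage 1 (by simp)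
  obtain ⟨xmin, hxmin⟩ := exists_map_eq_pole himage (-1) (by simp)
  rw [one_smul] at hxmax
  rw [neg_one_smul] at hxmin
  change f xmax = b at hxmax
  change f xmin = -b at hxmin
  have hmax1 : ‖f xmax‖ = 1 := by rw [hxmax, hb]
  have hmin1 : ‖f xmin‖ = 1 := by rw [hxmin, norm_neg, hb]
  obtain ⟨φ, hx, h0, r, hr, hφ⟩ := hf.exists_radial_chart himage hmax1
  obtain ⟨φ', hx', h0', r', hr', hφ'⟩ := hf.exists_radial_chart himage hmin1
  rw [hxmax] at hφ
  simp only [hxmin, inner_neg_left, neg_lt_neg_iff] at hφ'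
  have hbb : inner ℝ b b = (1 : ℝ) := by rw [real_inner_self_eq_norm_sq, hb, one_pow]
  have hne : xmax ≠ xmin := fun h => by
    rw [h, hxmin] at hxmax
    have : inner ℝ b (-b) = inner ℝ b b := congrArg (inner ℝ b) hxmax
    rw [inner_neg_right, hbb] at this
    linarith
  have hmin : ∀ x, x ≠ xmin → inner ℝ b (f xmin) < (inner ℝ b (f x) : ℝ) := fun x hxne => by
    have hle : ‖f x‖ ≤ 1 := by
      rw [← mem_closedBall_zero_iff, ← himage]
      exact ⟨x, rfl⟩
    rw [hxmin, inner_neg_right, hbb]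
    by_contra! hcon
    refine hxne (hf.eq_of_norm_eq_one himage hinj hmin1 ?_)
    -- The equality case of Cauchy–Schwarz: height at most `-1` in the unit ball forces `f x = -b`,
    -- a value taken only once.
    have h1 : ‖f x + b‖ ^ 2 = ‖f x‖ ^ 2 + 2 * inner ℝ b (f x) + 1 := by
      rw [norm_add_sq_real, hb, real_inner_comm, one_pow]
    have h2 : ‖f x‖ ^ 2 ≤ 1 := by nlinarith [norm_nonneg (f x)]
    have h3 : ‖f x + b‖ ^ 2 = 0 := le_antisymm (by linarith) (by positivity)
    rw [hxmin]
    exact eq_neg_of_add_eq_zero_left (norm_eq_zero.1 (pow_eq_zero_iff two_ne_zero |>.1 h3))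
  obtain ⟨j, hj, hr⟩ := exists_isOpenEmbedding_of_two_critical_points
    (g := fun x => inner ℝ b (f x)) (continuous_const.inner hf.2.2.1.continuous) hne hmin
    (fun x h1 h2 => hf.exists_hasStrictFDerivAt_ne_zero himage hinj hb
      (fun h => h2 (hf.eq_of_norm_eq_one himage hinj hmax1 (h.trans hxmax.symm)))
      (fun h => h1 (hf.eq_of_norm_eq_one himage hinj hmin1 (h.trans hxmin.symm))))
    φ hx h0 hr hφ φ' hx' h0' hr' hφ'
  exact _root_.nonempty_homeomorph_sphere hj hr

end IsSpecialGeneric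

end Ball

/-! ### Pulling back a manifold structure along a homeomorphism -/

namespace Homeomorph

variable {𝕜 E H W N : Type*} [NontriviallyNormedField 𝕜] [NormedAddCommGroup E] [NormedSpace 𝕜 E]
  [TopologicalSpace H] {I : ModelWithCorners 𝕜 E H} [TopologicalSpace W] [TopologicalSpace N]
  [ChartedSpace H N]

/-- The charted space structure for which the charts are the composites of `h` with charts. -/
@[reducible]
def pullbackChartedSpace (h : W ≃ₜ N) : ChartedSpace H W where
  atlas := (fun e => h.toOpenPartialHomeomorph.trans e) '' atlas H N
  chartAt x := h.toOpenPartialHomeomorph.trans (chartAt H (h x))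
  mem_chart_source x := by simp
  chart_mem_atlas x := ⟨_, chart_mem_atlas H (h x), rfl⟩

variable {n : ℕ∞ω} [IsManifold I n N] (h : W ≃ₜ N)

/-- In a transition map `h` cancels against its inverse, leaving a transition map of `N`. -/
theorem isManifold_pullback : letI := h.pullbackChartedSpace (H := H); IsManifold I n W := by
  let _ := h.pullbackChartedSpace (H := H)
  refine isManifold_of_contDiffOn I n W ?_
  rintro _ _ ⟨e, he, rfl⟩ ⟨e', he', rfl⟩
  have h1 := HasGroupoid.compatible (G := contDiffGroupoid n I) he he'
  rw [contDiffGroupoid, mem_groupoid_of_pregroupoid] at h1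
  refine h1.1.congr_mono ?_ ?_
  · intro y _
    simp
  · rintro y ⟨hy, hy'⟩
    refine ⟨?_, hy'⟩
    simpa using hy

theorem contMDiff_pullback : letI := h.pullbackChartedSpace (H := H); ContMDiff I I n h := by
  let _ := h.pullbackChartedSpace (H := H)
  have := h.isManifold_pullback (I := I) (n := n)
  intro x
  have h1 := (contMDiffAt_symm_of_mem_maximalAtlas (n := n) (I := I)
    (IsManifold.chart_mem_maximalAtlas (h x)) (mem_chart_target H (h x)))
  have h2 := contMDiffAt_of_mem_maximalAtlas (n := n) (I := I)
    (IsManifold.chart_mem_maximalAtlas x) (mem_chart_source H x)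
  refine (ContMDiffAt.comp x h1 h2).congr_of_eventuallyEq ?_
  filter_upwards [(chartAt H x).open_source.mem_nhds (mem_chart_source H x)] with z hz
  have hz' : h z ∈ (chartAt H (h x)).source := by
    have h3 : z ∈ (h.toOpenPartialHomeomorph.trans (chartAt H (h x))).source := hz
    simpa using h3
  exact ((chartAt H (h x)).left_inv hz').symm

theorem contMDiff_symm_pullback :
    letI := h.pullbackChartedSpace (H := H); ContMDiff I I n h.symm := by
  let _ := h.pullbackChartedSpace (H := H)
  have := h.isManifold_pullback (I := I) (n := n)
  intro y
  obtain ⟨x, rfl⟩ := h.surjective y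
  have h1 := (contMDiffAt_symm_of_mem_maximalAtlas (n := n) (I := I)
    (IsManifold.chart_mem_maximalAtlas x) (mem_chart_target H x))
  have h2 := contMDiffAt_of_mem_maximalAtlas (n := n) (I := I)
    (IsManifold.chart_mem_maximalAtlas (h x)) (mem_chart_source H (h x))
  refine (ContMDiffAt.comp (h x) h1 h2).congr_of_eventuallyEq ?_
  filter_upwards [(chartAt H (h x)).open_source.mem_nhds (mem_chart_source H (h x))] with z hz
  exact congrArg h.symm ((chartAt H (h x)).left_inv hz).symm

theorem preimage_boundary_pullback : letI := h.pullbackChartedSpace (H := H)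
    I.boundary W = h ⁻¹' I.boundary N := rfl

/-- The composite of an immersion with the diffeomorphism `h`. -/
theorem isImmersion_comp_pullback {E' H' P : Type*} [NormedAddCommGroup E'] [NormedSpace 𝕜 E']
    [TopologicalSpace H'] {J : ModelWithCorners 𝕜 E' H'} [TopologicalSpace P] [ChartedSpace H' P]
    {F : Type*} [NormedAddCommGroup F] [NormedSpace 𝕜 F] {i : N → P}
    (hi : Manifold.IsImmersionOfComplement F I J n i) :
    letI := h.pullbackChartedSpace (H := H)
    Manifold.IsImmersionOfComplement F I J n (i ∘ h) := by
  let _ := h.pullbackChartedSpace (H := H)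
  have := h.isManifold_pullback (I := I) (n := n)
  intro x
  have hx := hi (h x)
  refine .mk_of_charts hx.equiv (h.toOpenPartialHomeomorph.trans hx.domChart) hx.codChart
    (by simpa using hx.mem_domChart_source) hx.mem_codChart_source ?_ hx.codChart_mem_maximalAtlas
    ?_ ?_
  · refine OpenPartialHomeomorph.mem_maximalAtlas_of_contMDiffOn _ ?_ ?_
    · exact (contMDiffOn_of_mem_maximalAtlas hx.domChart_mem_maximalAtlas).comp
        h.contMDiff_pullback.contMDiffOn (fun z hz => by simpa using hz)
    · exact h.contMDiff_symm_pullback.comp_contMDiffOn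
        ((contMDiffOn_symm_of_mem_maximalAtlas hx.domChart_mem_maximalAtlas).mono
          (fun z hz => by simpa using hz))
  · intro z hz
    exact hx.source_subset_preimage_source (by simpa using hz)
  · intro y hy
    have hy' : y ∈ (hx.domChart.extend I).target := by simpa using hy
    simpa using hx.writtenInCharts hy'

end Homeomorph

/-! ### The closed ball in Euclidean space -/

namespace ClosedDisk

variable {p : ℕ} [NeZero p]

/-- The inversion as a chart of Euclidean space. -/
noncomputable def cayleyChart (p : ℕ) [NeZero p] :
    OpenPartialHomeomorph (EuclideanSpace ℝ (Fin p)) (EuclideanSpace ℝ (Fin p)) where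
  toFun := cayley
  invFun := cayley
  source := {x | x + pole p ≠ 0}
  target := {x | x + pole p ≠ 0}
  map_source' := cayley_add_pole_ne
  map_target' := cayley_add_pole_ne
  left_inv' := cayley_cayley
  right_inv' := cayley_cayley
  open_source := isOpen_ne_fun (by fun_prop) continuous_const
  open_target := isOpen_ne_fun (by fun_prop) continuous_const
  continuousOn_toFun := contDiffOn_cayley.continuousOn
  continuousOn_invFun := contDiffOn_cayley.continuousOn

/-- The composite of the antipodal map with the inversion. -/
noncomputable def cayleyNegChart (p : ℕ) [NeZero p] :
    OpenPartialHomeomorph (EuclideanSpace ℝ (Fin p)) (EuclideanSpace ℝ (Fin p)) :=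
  (Homeomorph.neg (EuclideanSpace ℝ (Fin p))).toOpenPartialHomeomorph.trans (cayleyChart p)

theorem cayleyChart_mem_maximalAtlas :
    cayleyChart p ∈ IsManifold.maximalAtlas (𝓡 p) ∞ (EuclideanSpace ℝ (Fin p)) :=
  OpenPartialHomeomorph.mem_maximalAtlas_of_contMDiffOn _ contDiffOn_cayley.contMDiffOn
    contDiffOn_cayley.contMDiffOn

theorem cayleyNegChart_mem_maximalAtlas :
    cayleyNegChart p ∈ IsManifold.maximalAtlas (𝓡 p) ∞ (EuclideanSpace ℝ (Fin p)) := by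
  refine OpenPartialHomeomorph.mem_maximalAtlas_of_contMDiffOn _ (ContDiffOn.contMDiffOn ?_)
    (ContDiffOn.contMDiffOn ?_)
  · exact contDiffOn_cayley.comp contDiff_neg.contDiffOn fun z hz => by
      simpa [cayleyNegChart, cayleyChart] using hz
  · exact contDiff_neg.comp_contDiffOn (contDiffOn_cayley.mono fun z hz => by
      simpa [cayleyNegChart, cayleyChart] using hz)

theorem chartPos_mem_atlas : chartPos p ∈ atlas (EuclideanHalfSpace p)
    (Metric.closedBall (0 : EuclideanSpace ℝ (Fin p)) 1) := Or.inl rfl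

theorem chartNeg_mem_atlas : chartNeg p ∈ atlas (EuclideanHalfSpace p)
    (Metric.closedBall (0 : EuclideanSpace ℝ (Fin p)) 1) := Or.inr rfl

/-- The inclusion of the closed ball in Euclidean space is an immersion. -/
theorem isImmersionOfComplement_subtypeVal :
    Manifold.IsImmersionOfComplement PUnit.{1} (𝓡∂ p) (𝓡 p) ∞
      (Subtype.val : Metric.closedBall (0 : EuclideanSpace ℝ (Fin p)) 1 → _) := by
  intro x
  by_cases hx : x ∈ (chartPos p).source
  -- Both charts are the same inversion, so in them the inclusion becomes that of the half-space;
  -- the codimension is zero, whence the trivial complement.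
  · refine .mk_of_charts (.prodUnique ℝ _ _) (chartPos p) (cayleyChart p) hx hx
      (IsManifold.subset_maximalAtlas chartPos_mem_atlas) cayleyChart_mem_maximalAtlas
      (fun z hz => hz) ?_
    rintro y hy
    obtain ⟨z, rfl⟩ : y ∈ Set.range (𝓡∂ p) := (OpenPartialHomeomorph.extend_target_subset_range _ hy)
    have hz : (𝓡∂ p).symm ((𝓡∂ p) z) = z := (𝓡∂ p).left_inv z
    have h1 := cayley_cayley _ (add_pole_ne_of_nonneg z.1 z.2)
    simp only [Function.comp_apply, OpenPartialHomeomorph.extend_coe_symm, hz]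
    exact h1
  · have hx := mem_chartNeg_source x hx
    have hsrc : ∀ z ∈ (chartNeg p).source, z.1 ∈ (cayleyNegChart p).source := fun z hz => by
      simpa [cayleyNegChart, cayleyChart, chartNeg, chartPos, antipode] using hz
    refine .mk_of_charts (.prodUnique ℝ _ _) (chartNeg p) (cayleyNegChart p) hx (hsrc x hx)
      (IsManifold.subset_maximalAtlas chartNeg_mem_atlas) cayleyNegChart_mem_maximalAtlas
      hsrc ?_
    rintro y hy
    obtain ⟨z, rfl⟩ : y ∈ Set.range (𝓡∂ p) := (OpenPartialHomeomorph.extend_target_subset_range _ hy)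
    have hz : (𝓡∂ p).symm ((𝓡∂ p) z) = z := (𝓡∂ p).left_inv z
    have h1 := cayley_cayley _ (add_pole_ne_of_nonneg z.1 z.2)
    simp only [Function.comp_apply, OpenPartialHomeomorph.extend_coe_symm, hz]
    change cayley (- -cayley z.1) = _
    rw [neg_neg]
    exact h1

/-- By `cayley_apply_zero` the height in the half-space is a positive multiple of `1 - ‖x‖ ^ 2` on
the domain of `chartPos`. The other chart differs by the antipodal map, which preserves the norm. -/
theorem boundary_closedBall :
    (𝓡∂ p).boundary (Metric.closedBall (0 : EuclideanSpace ℝ (Fin p)) 1) = {x | ‖x.1‖ = 1} := by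
  have key : ∀ x : Metric.closedBall (0 : EuclideanSpace ℝ (Fin p)) 1, x ∈ (chartPos p).source →
      (0 = (chartPos p x).1 0 ↔ ‖x.1‖ = 1) := fun x hx => by
    have h : ‖x.1 + pole p‖ ^ 2 ≠ 0 := by
      have : x.1 + pole p ≠ 0 := hx
      simpa using this
    rw [chartPos_apply x hx, cayley_apply_zero x.1 hx, eq_comm, div_eq_zero_iff, or_iff_left h,
      sub_eq_zero, eq_comm, pow_eq_one_iff_of_nonneg (norm_nonneg _) two_ne_zero]
  ext x
  rw [ModelWithCorners.boundary, Set.mem_ofPred_eq, ModelWithCorners.isBoundaryPoint_iff,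
    frontier_range_modelWithCornersEuclideanHalfSpace, Set.mem_ofPred_eq, Set.mem_ofPred_eq]
  by_cases hx : x ∈ (chartPos p).source
  · rw [← key x hx]
    have : chartAt (EuclideanHalfSpace p) x = chartPos p := if_pos hx
    rw [extChartAt, OpenPartialHomeomorph.extend_coe, this]
    rfl
  · have hx' : antipode p x ∈ (chartPos p).source := by
      simpa [chartNeg] using mem_chartNeg_source x hx
    have h1 := key _ hx'
    have : chartAt (EuclideanHalfSpace p) x = chartNeg p := if_neg hx
    rw [extChartAt, OpenPartialHomeomorph.extend_coe, this]
    rw [show ‖(antipode p x).1‖ = ‖x.1‖ from norm_neg x.1] at h1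
    exact h1

end ClosedDisk

/-! ### The Stein factorization -/

section SteinBall

variable {n p : ℕ} {M : Type*} [TopologicalSpace M] {f : M → EuclideanSpace ℝ (Fin p)}

/-- If the induced map is injective with image the closed ball, it is a homeomorphism onto it. -/
theorem exists_steinSpace_homeomorph [CompactSpace M] (hf : Continuous f)
    (himage : Set.range f = Metric.closedBall 0 1) (hinj : Function.Injective (steinMap f)) :
    ∃ h : SteinSpace f ≃ₜ Metric.closedBall (0 : EuclideanSpace ℝ (Fin p)) 1,
      ∀ w, (h w).1 = steinMap f w := by
  have hmem : ∀ w, steinMap f w ∈ Metric.closedBall (0 : EuclideanSpace ℝ (Fin p)) 1 := fun w => by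
    induction w using Quotient.inductionOn with
    | _ x => rw [← himage]; exact ⟨x, rfl⟩
  have hc : Continuous (steinMap f) := hf.quotient_lift _
  have hbij : Function.Bijective (fun w => (⟨steinMap f w, hmem w⟩ :
      Metric.closedBall (0 : EuclideanSpace ℝ (Fin p)) 1)) := by
    refine ⟨fun w w' hw => hinj (congrArg Subtype.val hw), ?_⟩
    rintro ⟨y, hy⟩
    rw [← himage] at hy
    obtain ⟨x, rfl⟩ := hy
    exact ⟨steinProj f x, rfl⟩
  exact ⟨Continuous.homeoOfEquivCompactToT2 (f := Equiv.ofBijective _ hbij)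
    (hc.subtype_mk hmem), fun w => rfl⟩

variable [NeZero p] [ChartedSpace (EuclideanSpace ℝ (Fin n)) M]

/-- A Stein structure is unique: the induced map is a diffeomorphism onto the closed ball. -/
theorem IsSteinStructure.nonempty_diffeomorph
    {cs : ChartedSpace (EuclideanHalfSpace p) (SteinSpace f)} (hcs : IsSteinStructure n f cs)
    (h : SteinSpace f ≃ₜ Metric.closedBall (0 : EuclideanSpace ℝ (Fin p)) 1)
    (hh : ∀ w, (h w).1 = steinMap f w) :
    Nonempty (Diffeomorph (𝓡∂ p) (𝓡∂ p) (SteinSpace f)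
      (Metric.closedBall (0 : EuclideanSpace ℝ (Fin p)) 1) ∞) := by
  have := hcs.isManifold
  have hi := (ClosedDisk.isImmersionOfComplement_subtypeVal (p := p))
  refine ⟨⟨h.toEquiv, ?_, ?_⟩⟩
  -- Smoothness of a continuous map may be tested after composing with an immersion. Composing `h`
  -- with the inclusion gives `steinMap f`, and composing its inverse with `steinMap f` gives the
  -- inclusion.
  · refine (ContMDiff.iff_comp_isImmersionOfComplement hi).2 ⟨h.continuous, ?_⟩
    have : (Subtype.val : Metric.closedBall (0 : EuclideanSpace ℝ (Fin p)) 1 → _) ∘ h =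
      steinMap f := funext hh
    exact this ▸ hcs.immersion_map.contMDiff
  · refine (ContMDiff.iff_comp_isImmersion hcs.immersion_map).2 ⟨h.symm.continuous, ?_⟩
    have : steinMap f ∘ h.symm = Subtype.val := funext fun y => by
      rw [Function.comp_apply, ← hh, h.apply_symm_apply]
    exact this ▸ hi.contMDiff

/-- The map `steinMap f` is the inclusion of the ball after `h`, hence an immersion; `steinProj f`
is smooth because its composite with this immersion is `f`. -/
theorem isSteinStructure_pullback (hf : ContMDiff (𝓡 n) (𝓡 p) ∞ f) [IsManifold (𝓡 n) ∞ M]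
    (hsing : singularLocus n f = {x | ‖f x‖ = 1})
    (h : SteinSpace f ≃ₜ Metric.closedBall (0 : EuclideanSpace ℝ (Fin p)) 1)
    (hh : ∀ w, (h w).1 = steinMap f w) :
    IsSteinStructure n f h.pullbackChartedSpace := by
  let _ := h.pullbackChartedSpace (H := EuclideanHalfSpace p)
  have := h.isManifold_pullback (I := 𝓡∂ p) (n := ∞)
  have himm : Manifold.IsImmersion (𝓡∂ p) (𝓡 p) ∞ (steinMap f) := by
    have h1 := (h.isImmersion_comp_pullback
      (ClosedDisk.isImmersionOfComplement_subtypeVal (p := p))).isImmersion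
    have : (Subtype.val : Metric.closedBall (0 : EuclideanSpace ℝ (Fin p)) 1 → _) ∘ h =
      steinMap f := funext hh
    exact this ▸ h1
  refine ⟨this, h.isEmbedding.t2Space, h.secondCountableTopology, ?_, ?_, himm⟩
  · exact (ContMDiff.iff_comp_isImmersion himm).2 ⟨continuous_quot_mk, hf⟩
  · rw [h.preimage_boundary_pullback, ClosedDisk.boundary_closedBall, hsing]
    ext x
    simp only [Set.mem_preimage, Set.mem_ofPred_eq, hh]
    rfl

end SteinBall

theorem mainTheorem9 {n p : ℕ} [NeZero p] {M : Type*} [TopologicalSpace M] [T2Space M]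
    [CompactSpace M] [ConnectedSpace M] [ChartedSpace (EuclideanSpace ℝ (Fin n)) M]
    [IsManifold (𝓡 n) ∞ M] (f : M → EuclideanSpace ℝ (Fin p)) (hf : IsSpecialGeneric n f)
    (himage : Set.range f = Metric.closedBall 0 1)
    (hinj : Function.Injective (steinMap f)) :
    IsHomotopySphere n M ∧ IsStandard n f := by
  obtain ⟨e⟩ := hf.nonempty_homeomorph_sphere himage hinj
  have hsphere : IsHomotopySphere n M :=
    ⟨inferInstance, inferInstance, inferInstance, ⟨e.toHomotopyEquiv⟩⟩
  obtain ⟨h, hh⟩ := exists_steinSpace_homeomorph hf.2.2.1.continuous himage hinj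
  exact ⟨hsphere, hsphere, hf, hf.dim_lt himage hinj,
    ⟨_, isSteinStructure_pullback hf.2.2.1 (hf.singularLocus_eq himage hinj) h hh⟩,
    fun _ hcs => hcs.nonempty_diffeomorph h hh⟩
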